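/- Let $\gamma$ be the standard complex Gaussian measure on $\mathbb{C}^n$, $d\gamma(w)=\pi^{-n}e^{-|w|^2}\,d\ell(w)$, where $\ell$ is Lebesgue measure on $\mathbb{C}^n\simeq\mathbb{R}^{2n}$ and $|w|^2=\sum_j|w_j|^2$. A function $u:\mathbb{C}^n\to[-\infty,+\infty)$ is called plurisubharmonic if it is upper semicontinuous and, for all $a,b\in\mathbb{C}^n$, the function $z\in\mathbb{C}\mapsto u(a+zb)$ is subharmonic (the function identically $-\infty$ on $\mathbb{C}$ being admitted as subharmonic). Let $\mathcal{G}$ be the class of functions $u$ on $\mathbb{C}^n$ that are locally square integrable with respect to Lebesgue measure and for which there exist $\varepsilon,c,C>0$ such that $|u(w)|\le e^{c|w|^{2-\varepsilon}}$ for almost every $w$ with $|w|\ge C$. Let $f,g:\mathbb{C}^n\to[-\infty,+\infty)$ be two plurisubharmonic functions belonging to $\mathcal{G}$, and suppose that $f$ is circular-symmetric, i.e. $f(e^{i\theta}w)=f(w)$ for all $\theta\in\mathbb{R}$ and $w\in\mathbb{C}^n$. Then $f$ and $g$ are finite $\gamma$-almost everywhere, $f$, $g$ and $fg$ are $\gamma$-integrable,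 and $$\int fg\,d\gamma\ \ge\ \int f\,d\gamma\int g\,d\gamma .$$ -/

import Mathlib

open MeasureTheory
open scoped ENNReal

noncomputable section

namespace GaussianPsh

/-- The space `ℂⁿ` with its Hermitian norm `‖w‖ = (∑ |w_j|²)^{1/2}`; its `volume` is the Lebesgue
measure of `ℂⁿ ≃ ℝ²ⁿ`. -/
abbrev Cn (n : ℕ) : Type := EuclideanSpace ℂ (Fin n)

/-- The standard complex Gaussian measure `π⁻ⁿ e^{-|w|²} dℓ(w)` on `ℂⁿ`. -/
def stdGaussian (n : ℕ) : Measure (Cn n) :=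
  (volume : Measure (Cn n)).withDensity
    fun w => ENNReal.ofReal ((Real.pi ^ n)⁻¹ * Real.exp (-‖w‖ ^ 2))

/-- The integral `∫ u⁺ dμ - ∫ u⁻ dμ` of an extended real valued function. It is the usual one as
soon as one of the two integrals is finite, in particular when `u` is bounded above on a space of
finite measure. -/
def eintegral {α : Type*} [MeasurableSpace α] (μ : Measure α) (u : α → EReal) : EReal :=
  ((∫⁻ x, (u x).toENNReal ∂μ : ℝ≥0∞) : EReal) - ((∫⁻ x, (-u x).toENNReal ∂μ : ℝ≥0∞) : EReal)

/-- The uniform probability measure on the interval `(0, 2π]` of angles. -/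
def angleMeasure : Measure ℝ :=
  ENNReal.ofReal (2 * Real.pi)⁻¹ • volume.restrict (Set.Ioc 0 (2 * Real.pi))

/-- A function `u : ℂ → [-∞, +∞)` is subharmonic if it is upper semicontinuous and satisfies the
sub-mean value inequality `u(c) ≤ (1/2π) ∫₀^{2π} u(c + r e^{iθ}) dθ` on every circle. The constant
function `-∞` is admitted. -/
structure Subharmonic (u : ℂ → EReal) : Prop where
  lt_top : ∀ z, u z < ⊤
  usc : UpperSemicontinuous u
  le_mean : ∀ (c : ℂ) (r : ℝ), 0 < r → u c ≤ eintegral angleMeasure fun θ => u (circleMap c r θ)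

/-- A function `u : ℂⁿ → [-∞, +∞)` is plurisubharmonic if it is upper semicontinuous and
subharmonic along every complex line. -/
structure Plurisubharmonic {n : ℕ} (u : Cn n → EReal) : Prop where
  lt_top : ∀ w, u w < ⊤
  usc : UpperSemicontinuous u
  subharmonic_line : ∀ a b : Cn n, Subharmonic fun z : ℂ => u (a + z • b)

/-- The class `𝒢` of locally square integrable functions `u` such that, for some `ε, c, C > 0`,
`|u(w)| ≤ exp (c |w|^{2-ε})` for (almost) all `|w| ≥ C`. Here `|-∞| = ∞`, so local square
integrability forces `u` to be finite almost everywhere. -/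
structure GrowthClass {n : ℕ} (u : Cn n → EReal) : Prop where
  aemeasurable : AEMeasurable u (volume : Measure (Cn n))
  locally_sq_integrable : ∀ K : Set (Cn n), IsCompact K → ∫⁻ w in K, (u w).abs ^ 2 < ∞
  growth : ∃ ε c C : ℝ, 0 < ε ∧ 0 < c ∧ 0 < C ∧
    ∀ᵐ w : Cn n, C ≤ ‖w‖ → (u w).abs ≤ ENNReal.ofReal (Real.exp (c * ‖w‖ ^ (2 - ε)))

/-- Invariance under multiplication by complex numbers of modulus one. -/
def CircularSymmetric {n : ℕ} (u : Cn n → EReal) : Prop :=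
  ∀ (θ : ℝ) (w : Cn n), u (Complex.exp (θ * Complex.I) • w) = u w

end GaussianPsh

end

/-!
For `|ρ| ≤ 1` let `F(ρ) = E f(X) g(Y)`, where `X`, `Y` are standard complex Gaussian vectors with
complex correlation `ρ` (`corr f g ρ`, with `Y = ρ X + √(1 - |ρ|²) X'` for an independent copy `X'`).
Then `F(0) = ∫ f dγ ∫ g dγ` and `F(1) = ∫ f g dγ`. Since `f` is circular-symmetric, `F` is radial
(`corr_eq_corr_norm`), so the inequality `F(0) ≤ F(1)` follows from the maximum principle
(`corr_zero_le_corr_one`) once `F` is continuous on `[0, 1]` (`continuousOn_corr`) and subharmonic.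
For smooth functions `∂²F/∂ρ∂ρ̄` is the expectation of the trace of the product of the two Levi
matrices of `f` and `g`, which is nonnegative because both are positive semidefinite.

No smoothness is assumed, so all derivatives are put on Gaussian densities. At a point
`r ∈ [0, 1)` the correlation `r + (1 - r) t ω`, `|ω| = 1`, is realised by
`X = √r Z + √(1-r) U`, `Y = √r Z + √(1-r) V`, where `Z` is independent of `(U, V)` and `(U, V)` has
correlation `t ω` (`integral_corr_split`). The density of `(U, V)` relative to `γ ⊗ γ` is
`exp (t x + t² y)` with explicit `x`, `y`; it is expanded to second order at `t = 0` by dominated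
convergence (`tendsto_corr_quotient`). In the mean over `ω = 1, -1, i, -i` the first order terms
cancel, and the coefficient of `t²` is the integral of `f ⊗ g` against
`|⟨u, v⟩|² - |u|² - |v|² + n`, for fixed `Z` (`exists_tendsto_four_point_mean`).

This kernel equals `∑ j k, (u_j ū_k - δ_{jk}) (v_k v̄_j - δ_{jk})`, so the integral is `tr (A B)` with
`A = ∫ f (u_j ū_k - δ_{jk}) dγ` and `B` the like matrix of `g` (`leviMatrix`). The matrix `A` is
positive semidefinite (`leviMatrix_posSemidef`): `⟨A c, c⟩` is the second order term of
`∫ f(u + t e^{iθ} c) dθ dγ(u) - ∫ f dγ`, which is nonnegative by the sub-mean value inequality on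
circles (`integral_mul_levi_nonneg`). The growth condition enters only through the integrability of
`f² e^{κ|w|²}` against `γ` for every `κ < 1` (`Tame`).
-/

namespace GaussianPsh

/-! ### The Gaussian measure -/

section Gaussian

open Complex

variable {n : ℕ}

lemma finrank_real_Cn (n : ℕ) : Module.finrank ℝ (Cn n) = 2 * n := by
  rw [← Module.finrank_mul_finrank ℝ ℂ (Cn n)]; simp

lemma inner_real_eq_re (x y : Cn n) : inner ℝ x y = (inner ℂ x y).re := by
  simp [PiLp.inner_apply, Complex.inner]

/-- Transposing a complex scalar in the real inner product conjugates it. -/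
lemma inner_real_smul_right (α : ℂ) (x y : Cn n) :
    inner ℝ x (α • y) = inner ℝ (starRingEnd ℂ α • x) y := by
  rw [inner_real_eq_re, inner_real_eq_re, inner_smul_left, inner_smul_right, Complex.conj_conj]

lemma lintegral_stdGaussian (h : Cn n → ℝ≥0∞) :
    ∫⁻ w, h w ∂stdGaussian n
      = ∫⁻ w, ENNReal.ofReal ((Real.pi ^ n)⁻¹ * Real.exp (-‖w‖ ^ 2)) * h w := by
  rw [stdGaussian, lintegral_withDensity_eq_lintegral_mul_non_measurable]
  · rfl
  · fun_prop
  · exact Filter.Eventually.of_forall fun _ => ENNReal.ofReal_lt_top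

/-- The characteristic function of `γ`, whose real coordinates have variance `1/2`. -/
lemma integral_cexp_inner (w : Cn n) :
    ∫ x, cexp ((inner ℝ w x : ℝ) * I) ∂stdGaussian n = cexp (-‖w‖ ^ 2 / 4) := by
  have h := GaussianFourier.integral_cexp_neg_mul_sq_norm_add (b := 1) (by simp) I w
  rw [stdGaussian, integral_withDensity_eq_integral_toReal_smul (by fun_prop)
    (Filter.Eventually.of_forall fun _ => ENNReal.ofReal_lt_top)]
  rw [finrank_real_Cn] at h
  have e : ∀ x : Cn n, (ENNReal.ofReal ((Real.pi ^ n)⁻¹ * Real.exp (-‖x‖ ^ 2))).toReal •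
      cexp ((inner ℝ w x : ℝ) * I)
      = ((Real.pi : ℂ) ^ n)⁻¹ * cexp (-1 * ‖x‖ ^ 2 + I * (inner ℝ w x : ℝ)) := by
    intro x
    rw [ENNReal.toReal_ofReal (by positivity), Complex.exp_add]
    simp only [real_smul]
    push_cast
    ring_nf
  simp_rw [e]
  rw [integral_const_mul, h]
  have : ((2 * n : ℕ) : ℂ) / 2 = (n : ℂ) := by push_cast; ring
  rw [this, cpow_natCast, div_one, ← mul_assoc, inv_mul_cancel₀, one_mul]
  · congr 1; simp
  · exact pow_ne_zero _ (by exact_mod_cast Real.pi_ne_zero)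

instance : IsProbabilityMeasure (stdGaussian n) := by
  constructor
  have h := integral_cexp_inner (0 : Cn n)
  simp only [inner_zero_left, ofReal_zero, zero_mul, Complex.exp_zero, norm_zero] at h
  simp only [integral_const, real_smul, mul_one] at h
  norm_num at h
  have h2 : (stdGaussian n).real Set.univ = 1 := by exact_mod_cast h
  rw [Measure.real] at h2
  rw [← ENNReal.toReal_eq_one_iff]; exact h2

/-- The density with respect to `γ` of the law of `a + s • v`, for `v` of law `γ`. -/
noncomputable def affineDensity (a : Cn n) (s : ℝ) (y : Cn n) : ℝ :=
  (s ^ (2 * n))⁻¹ * Real.exp (‖y‖ ^ 2 - ‖y - a‖ ^ 2 / s ^ 2)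

/-- The image of `γ` under a translation composed with a homothety has an explicit density with
respect to `γ`. -/
lemma map_add_smul_stdGaussian (a : Cn n) {s : ℝ} (hs : 0 < s) :
    (stdGaussian n).map (fun v => a + s • v) = (stdGaussian n).withDensity fun y =>
      ENNReal.ofReal (affineDensity a s y) := by
  have hvol : (volume : Measure (Cn n)).map (fun v => a + s • v)
      = ENNReal.ofReal ((s ^ (2 * n))⁻¹) • volume := by
    have h1 := Measure.map_addHaar_smul (volume : Measure (Cn n)) hs.ne'
    rw [finrank_real_Cn, abs_of_pos (by positivity)] at h1
    have h2 : (fun v : Cn n => a + s • v) = (fun v => a + v) ∘ (fun v => s • v) := rfl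
    rw [h2, ← Measure.map_map (by fun_prop) (by fun_prop), h1, Measure.map_smul,
      map_add_left_eq_self]
  ext A hA
  rw [Measure.map_apply (by fun_prop) hA, withDensity_apply _ hA, ← lintegral_indicator hA,
    lintegral_stdGaussian, ← lintegral_indicator_one (hA.preimage (by fun_prop)),
    lintegral_stdGaussian]
  set G : Cn n → ℝ≥0∞ := fun y =>
    ENNReal.ofReal ((Real.pi ^ n)⁻¹ * Real.exp (-(‖y - a‖ ^ 2 / s ^ 2))) * A.indicator 1 y with hG
  have hGm : Measurable G := by
    apply Measurable.mul (by fun_prop)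
    exact measurable_one.indicator hA
  have e1 : ∀ v : Cn n, ENNReal.ofReal ((Real.pi ^ n)⁻¹ * Real.exp (-‖v‖ ^ 2)) *
      ((fun v => a + s • v) ⁻¹' A).indicator 1 v = G (a + s • v) := by
    intro v
    simp only [hG, add_sub_cancel_left, norm_smul, Real.norm_eq_abs, abs_of_pos hs, mul_pow]
    rw [mul_div_cancel_left₀ _ (by positivity)]
    rfl
  simp_rw [e1]
  rw [← lintegral_map hGm (by fun_prop), hvol, lintegral_smul_measure, smul_eq_mul,
    ← lintegral_const_mul _ hGm]
  refine lintegral_congr fun y => ?_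
  simp only [hG, affineDensity]
  by_cases hy : y ∈ A
  · simp only [hy, Set.indicator_of_mem, Pi.one_apply, mul_one]
    rw [← ENNReal.ofReal_mul (by positivity), ← ENNReal.ofReal_mul (by positivity)]
    congr 1
    rw [show ‖y‖ ^ 2 - ‖y - a‖ ^ 2 / s ^ 2 = ‖y‖ ^ 2 + -(‖y - a‖ ^ 2 / s ^ 2) by ring, Real.exp_add]
    rw [Real.exp_neg (‖y‖ ^ 2)]
    field_simp
  · simp [hy]

/-- The joint characteristic function of two linear combinations of three independent Gaussian
vectors: it sees the coefficients only through their Gram matrix. -/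
lemma integral_cexp_pair (a b : Fin 3 → ℂ) (ξ ζ : Cn n) :
    ∫ p : Cn n × Cn n × Cn n,
      cexp ((inner ℝ ξ (a 0 • p.1 + a 1 • p.2.1 + a 2 • p.2.2)
        + inner ℝ ζ (b 0 • p.1 + b 1 • p.2.1 + b 2 • p.2.2) : ℝ) * I)
      ∂((stdGaussian n).prod ((stdGaussian n).prod (stdGaussian n)))
    = cexp (-((∑ i, normSq (a i) : ℝ) * ‖ξ‖ ^ 2 + (∑ i, normSq (b i) : ℝ) * ‖ζ‖ ^ 2
        + 2 * (inner ℝ ξ ((∑ i, a i * starRingEnd ℂ (b i)) • ζ) : ℝ)) / 4) := by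
  set η : Fin 3 → Cn n := fun i => starRingEnd ℂ (a i) • ξ + starRingEnd ℂ (b i) • ζ with hη
  have e : ∀ p : Cn n × Cn n × Cn n,
      cexp ((inner ℝ ξ (a 0 • p.1 + a 1 • p.2.1 + a 2 • p.2.2)
        + inner ℝ ζ (b 0 • p.1 + b 1 • p.2.1 + b 2 • p.2.2) : ℝ) * I)
      = cexp ((inner ℝ (η 0) p.1 : ℝ) * I) *
        (cexp ((inner ℝ (η 1) p.2.1 : ℝ) * I) * cexp ((inner ℝ (η 2) p.2.2 : ℝ) * I)) := by
    intro p
    rw [← Complex.exp_add, ← Complex.exp_add]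
    congr 1
    simp only [hη, inner_add_right, inner_real_smul_right, inner_add_left]
    push_cast
    ring
  simp_rw [e]
  rw [integral_prod_mul (f := fun x => cexp ((inner ℝ (η 0) x : ℝ) * I))
    (g := fun q : Cn n × Cn n => cexp ((inner ℝ (η 1) q.1 : ℝ) * I) *
      cexp ((inner ℝ (η 2) q.2 : ℝ) * I)),
    integral_prod_mul (f := fun x => cexp ((inner ℝ (η 1) x : ℝ) * I))
    (g := fun x => cexp ((inner ℝ (η 2) x : ℝ) * I)),
    integral_cexp_inner, integral_cexp_inner, integral_cexp_inner, ← Complex.exp_add,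
    ← Complex.exp_add]
  congr 1
  have hn : ∀ i, ‖η i‖ ^ 2 = normSq (a i) * ‖ξ‖ ^ 2 + normSq (b i) * ‖ζ‖ ^ 2
      + 2 * inner ℝ ξ ((a i * starRingEnd ℂ (b i)) • ζ) := by
    intro i
    rw [hη]
    simp only
    rw [norm_add_sq_real, norm_smul, norm_smul, mul_pow, mul_pow, ← Complex.normSq_eq_norm_sq,
      ← Complex.normSq_eq_norm_sq, normSq_conj, normSq_conj, mul_smul,
      inner_real_smul_right (a i) ξ]
    ring
  have hn' : ∀ i, ((‖η i‖ : ℂ)) ^ 2 = ((normSq (a i) * ‖ξ‖ ^ 2 + normSq (b i) * ‖ζ‖ ^ 2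
      + 2 * inner ℝ ξ ((a i * starRingEnd ℂ (b i)) • ζ) : ℝ) : ℂ) := by
    intro i; rw [← hn i]; push_cast; rfl
  rw [hn', hn', hn']
  simp only [Fin.sum_univ_three, add_smul, inner_add_right]
  push_cast
  ring

/-- Finite measures on a product are determined by their characteristic functions. -/
lemma ext_of_integral_cexp_pair {μ ν : Measure (Cn n × Cn n)} [IsFiniteMeasure μ]
    [IsFiniteMeasure ν]
    (h : ∀ ξ ζ : Cn n, ∫ p, cexp ((inner ℝ ξ p.1 + inner ℝ ζ p.2 : ℝ) * I) ∂μ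
      = ∫ p, cexp ((inner ℝ ξ p.1 + inner ℝ ζ p.2 : ℝ) * I) ∂ν) : μ = ν := by
  apply Measure.ext_of_charFunDual
  funext L
  have hL : ∀ p : Cn n × Cn n, L p
      = inner ℝ ((InnerProductSpace.toDual ℝ (Cn n)).symm (L.comp (.inl ℝ _ _))) p.1
      + inner ℝ ((InnerProductSpace.toDual ℝ (Cn n)).symm (L.comp (.inr ℝ _ _))) p.2 := by
    intro p
    rw [InnerProductSpace.toDual_symm_apply, InnerProductSpace.toDual_symm_apply]
    simp [← map_add]
  simp only [charFunDual_apply]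
  simp_rw [hL]
  exact h _ _

/-- The law of a pair of linear combinations of independent Gaussian vectors depends only on the
Gram matrix of the coefficients. -/
lemma map_pair_eq_of_gram {a b a' b' : Fin 3 → ℂ}
    (haa : ∑ i, normSq (a i) = ∑ i, normSq (a' i))
    (hbb : ∑ i, normSq (b i) = ∑ i, normSq (b' i))
    (hab : ∑ i, a i * starRingEnd ℂ (b i) = ∑ i, a' i * starRingEnd ℂ (b' i)) :
    ((stdGaussian n).prod ((stdGaussian n).prod (stdGaussian n))).map (fun p =>
      (a 0 • p.1 + a 1 • p.2.1 + a 2 • p.2.2, b 0 • p.1 + b 1 • p.2.1 + b 2 • p.2.2))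
    = ((stdGaussian n).prod ((stdGaussian n).prod (stdGaussian n))).map (fun p =>
      (a' 0 • p.1 + a' 1 • p.2.1 + a' 2 • p.2.2, b' 0 • p.1 + b' 1 • p.2.1 + b' 2 • p.2.2)) := by
  have m : ∀ a b : Fin 3 → ℂ, Measurable (fun p : Cn n × Cn n × Cn n =>
      (a 0 • p.1 + a 1 • p.2.1 + a 2 • p.2.2, b 0 • p.1 + b 1 • p.2.1 + b 2 • p.2.2)) :=
    fun a b => by fun_prop
  have c : ∀ ξ ζ : Cn n, Continuous fun p : Cn n × Cn n =>
      cexp ((inner ℝ ξ p.1 + inner ℝ ζ p.2 : ℝ) * I) := fun ξ ζ => by fun_prop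
  have i1 := Measure.isProbabilityMeasure_map
    (μ := (stdGaussian n).prod ((stdGaussian n).prod (stdGaussian n))) (m a b).aemeasurable
  have i2 := Measure.isProbabilityMeasure_map
    (μ := (stdGaussian n).prod ((stdGaussian n).prod (stdGaussian n))) (m a' b').aemeasurable
  refine ext_of_integral_cexp_pair fun ξ ζ => ?_
  rw [integral_map (m _ _).aemeasurable (c ξ ζ).aestronglyMeasurable,
    integral_map (m _ _).aemeasurable (c ξ ζ).aestronglyMeasurable,
    integral_cexp_pair, integral_cexp_pair, haa, hbb, hab]

lemma measurePreserving_fst_snd_fst : MeasurePreserving (fun p : Cn n × Cn n × Cn n => (p.1, p.2.1))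
    ((stdGaussian n).prod ((stdGaussian n).prod (stdGaussian n)))
    ((stdGaussian n).prod (stdGaussian n)) :=
  (MeasurePreserving.id _).prod measurePreserving_fst

/-- `γ ⊗ γ` is invariant under the unitary group `U(2)` acting on pairs. -/
lemma measurePreserving_rotation {α β : ℂ} (h : normSq α + normSq β = 1) :
    MeasurePreserving (fun p : Cn n × Cn n =>
      (α • p.1 + β • p.2, -starRingEnd ℂ β • p.1 + starRingEnd ℂ α • p.2))
      ((stdGaussian n).prod (stdGaussian n)) ((stdGaussian n).prod (stdGaussian n)) := by
  refine ⟨by fun_prop, ?_⟩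
  have key := map_pair_eq_of_gram (n := n) (a := ![α, β, 0])
    (b := ![-starRingEnd ℂ β, starRingEnd ℂ α, 0]) (a' := ![1, 0, 0]) (b' := ![0, 1, 0])
    (by simpa [Fin.sum_univ_three] using h)
    (by simpa [Fin.sum_univ_three, add_comm] using h)
    (by simp [Fin.sum_univ_three]; ring)
  simp only [Matrix.cons_val_zero, Matrix.cons_val_one, Matrix.cons_val, zero_smul, add_zero,
    one_smul, zero_add] at key
  rw [measurePreserving_fst_snd_fst.map_eq] at key
  conv_lhs => rw [← measurePreserving_fst_snd_fst.map_eq]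
  rw [Measure.map_map (by fun_prop) (by fun_prop)]
  exact key

lemma measurePreserving_smul_add_smul {α β : ℂ} (h : normSq α + normSq β = 1) :
    MeasurePreserving (fun p : Cn n × Cn n => α • p.1 + β • p.2)
      ((stdGaussian n).prod (stdGaussian n)) (stdGaussian n) :=
  measurePreserving_fst.comp (measurePreserving_rotation h)

lemma measurePreserving_smul {α : ℂ} (h : normSq α = 1) :
    MeasurePreserving (fun w : Cn n => α • w) (stdGaussian n) (stdGaussian n) := by
  refine ⟨by fun_prop, ?_⟩
  have := (measurePreserving_smul_add_smul (n := n) (α := α) (β := 0) (by simpa using h)).map_eq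
  simp only [zero_smul, add_zero] at this
  conv_lhs => rw [← (measurePreserving_fst (μ := stdGaussian n) (ν := stdGaussian n)).map_eq]
  rw [Measure.map_map (by fun_prop) (by fun_prop)]
  exact this

end Gaussian

/-! ### Second order expansion of exponential densities -/

section Scalar

open Filter Topology

lemma abs_exp_sub_one_sub_id_le_sq_mul_exp (w : ℝ) :
    |Real.exp w - 1 - w| ≤ w ^ 2 * Real.exp |w| := by
  have h := Complex.norm_exp_sub_sum_le_norm_mul_exp (w : ℂ) 2
  simp only [Finset.sum_range_succ, Finset.sum_range_zero] at h
  norm_num at h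
  rw [show Complex.exp w - (1 + w) = ((Real.exp w - 1 - w : ℝ) : ℂ) by push_cast; ring,
    Complex.norm_real, Real.norm_eq_abs] at h
  exact h

lemma abs_exp_sub_one_sub_id_sub_sq_le (w : ℝ) :
    |Real.exp w - 1 - w - w ^ 2 / 2| ≤ |w| ^ 3 * Real.exp |w| := by
  have h := Complex.norm_exp_sub_sum_le_norm_mul_exp (w : ℂ) 3
  simp only [Finset.sum_range_succ, Finset.sum_range_zero] at h
  norm_num [Nat.factorial] at h
  rw [show Complex.exp w - (1 + w + w ^ 2 / 2) = ((Real.exp w - 1 - w - w ^ 2 / 2 : ℝ) : ℂ) by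
    push_cast; ring, Complex.norm_real, Real.norm_eq_abs] at h
  exact h

lemma one_add_le_mul_exp {δ S : ℝ} (hδ : 0 < δ) (hS : 0 ≤ S) :
    1 + S ≤ (1 + 1 / δ) * Real.exp (δ * S) := by
  have h1 : 1 + δ * S ≤ Real.exp (δ * S) := by linarith [Real.add_one_le_exp (δ * S)]
  have h2 : 1 + S ≤ (1 + 1 / δ) * (1 + δ * S) := by
    have : (1 + 1 / δ) * (1 + δ * S) = 1 + S + (δ * S + 1 / δ) := by field_simp; ring
    rw [this]
    have : 0 ≤ δ * S + 1 / δ := by positivity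
    linarith
  exact h2.trans (mul_le_mul_of_nonneg_left h1 (by positivity))

/-- Uniform bound for the second order remainder of `t ↦ exp (t x + t² y)`, when `x` and `y` grow
at most linearly in a parameter `S`. -/
lemma exists_abs_exp_remainder_le {K κ : ℝ} (hK : 0 ≤ K) (hκ : 0 < κ) :
    ∃ C τ : ℝ, 0 ≤ C ∧ 0 < τ ∧ ∀ t S x y : ℝ, 0 < t → t ≤ τ → 0 ≤ S → |x| ≤ K * (1 + S) →
      |y| ≤ K * (1 + S) →
      |(Real.exp (t * x + t ^ 2 * y) - 1 - t * x) / t ^ 2| ≤ C * Real.exp (κ * S) := by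
  set δ := κ / 4 with hδ
  have hδ0 : 0 < δ := by positivity
  set L := 1 + 1 / δ with hL
  have hL1 : 1 ≤ L := by rw [hL]; have : 0 < 1 / δ := by positivity
                         linarith
  refine ⟨K * L + 4 * K ^ 2 * L ^ 2 * Real.exp (2 * δ), min 1 (δ / (K + 1)), by positivity,
    by positivity, fun t S x y ht htτ hS hx hy => ?_⟩
  have ht1 : t ≤ 1 := htτ.trans (min_le_left _ _)
  have htK : t * K ≤ δ := by
    have h1 : t * (K + 1) ≤ δ := by
      rw [← le_div_iff₀ (by positivity)]; exact htτ.trans (min_le_right _ _)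
    nlinarith
  have hS1 := one_add_le_mul_exp hδ0 hS
  set E := Real.exp (δ * S) with hE
  have hE1 : 1 ≤ E := Real.one_le_exp (by positivity)
  set w := t * x + t ^ 2 * y with hw
  have hwabs : |w| ≤ t * (2 * K * (1 + S)) := by
    calc |w| ≤ |t * x| + |t ^ 2 * y| := abs_add_le _ _
      _ = t * |x| + t ^ 2 * |y| := by
        rw [abs_mul, abs_mul, abs_of_pos ht, abs_of_pos (pow_pos ht 2)]
      _ ≤ t * (K * (1 + S)) + t * (K * (1 + S)) := by
        refine add_le_add (mul_le_mul_of_nonneg_left hx ht.le) ?_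
        refine mul_le_mul (by nlinarith) hy (abs_nonneg _) ht.le
      _ = _ := by ring
  have hexp : Real.exp |w| ≤ Real.exp (2 * δ) * E ^ 2 := by
    rw [hE, ← Real.exp_nat_mul, ← Real.exp_add]
    refine Real.exp_le_exp.2 (hwabs.trans ?_)
    push_cast
    nlinarith
  have key : |Real.exp w - 1 - t * x| ≤
      t ^ 2 * (K * (1 + S)) + (t * (2 * K * (1 + S))) ^ 2 * (Real.exp (2 * δ) * E ^ 2) := by
    calc |Real.exp w - 1 - t * x| = |t ^ 2 * y + (Real.exp w - 1 - w)| := by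
          congr 1; rw [hw]; ring
      _ ≤ |t ^ 2 * y| + |Real.exp w - 1 - w| := abs_add_le _ _
      _ ≤ t ^ 2 * (K * (1 + S)) + w ^ 2 * Real.exp |w| := by
          refine add_le_add ?_ (abs_exp_sub_one_sub_id_le_sq_mul_exp w)
          rw [abs_mul, abs_of_pos (by positivity : 0 < t ^ 2)]
          exact mul_le_mul_of_nonneg_left hy (by positivity)
      _ ≤ _ := by
          refine add_le_add le_rfl (mul_le_mul ?_ hexp (by positivity) (by positivity))
          rw [← sq_abs w]
          exact pow_le_pow_left₀ (abs_nonneg _) hwabs 2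
  rw [abs_div, abs_of_pos (by positivity : 0 < t ^ 2), div_le_iff₀ (by positivity)]
  refine key.trans ?_
  have hκS : Real.exp (κ * S) = E ^ 4 := by
    rw [hE, ← Real.exp_nat_mul]; congr 1; rw [hδ]; push_cast; ring
  rw [hκS]
  have hE4 : E ≤ E ^ 4 := le_self_pow₀ hE1 (by norm_num)
  have h1 : K * (1 + S) ≤ K * L * E ^ 4 := by
    rw [mul_assoc]
    refine mul_le_mul_of_nonneg_left (hS1.trans ?_) hK
    exact mul_le_mul_of_nonneg_left hE4 (by positivity)
  have h2 : (2 * K * (1 + S)) ^ 2 ≤ 4 * K ^ 2 * L ^ 2 * E ^ 2 := by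
    calc (2 * K * (1 + S)) ^ 2 ≤ (2 * K * (L * E)) ^ 2 :=
          pow_le_pow_left₀ (by positivity) (mul_le_mul_of_nonneg_left hS1 (by positivity)) 2
      _ = _ := by ring
  calc t ^ 2 * (K * (1 + S)) + (t * (2 * K * (1 + S))) ^ 2 * (Real.exp (2 * δ) * E ^ 2)
      = t ^ 2 * (K * (1 + S) + (2 * K * (1 + S)) ^ 2 * (Real.exp (2 * δ) * E ^ 2)) := by ring
    _ ≤ t ^ 2 * (K * L * E ^ 4 + 4 * K ^ 2 * L ^ 2 * E ^ 2 * (Real.exp (2 * δ) * E ^ 2)) := by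
        gcongr
    _ = _ := by ring

lemma tendsto_exp_remainder (x : ℝ) {y : ℝ → ℝ} {y₀ : ℝ} (hy : Tendsto y (𝓝[>] 0) (𝓝 y₀)) :
    Tendsto (fun t => (Real.exp (t * x + t ^ 2 * y t) - 1 - t * x) / t ^ 2) (𝓝[>] 0)
      (𝓝 (x ^ 2 / 2 + y₀)) := by
  have ht : Tendsto (fun t : ℝ => t) (𝓝[>] 0) (𝓝 0) := tendsto_nhdsWithin_of_tendsto_nhds tendsto_id
  have hu : Tendsto (fun t => x + t * y t) (𝓝[>] 0) (𝓝 x) := by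
    simpa using tendsto_const_nhds.add (ht.mul hy)
  have hw : Tendsto (fun t => t * (x + t * y t)) (𝓝[>] 0) (𝓝 0) := by
    simpa using ht.mul hu
  have hbound : Tendsto (fun t => t * |x + t * y t| ^ 3 * Real.exp |t * (x + t * y t)|) (𝓝[>] 0)
      (𝓝 0) := by
    have h1 := (ht.mul (hu.abs.pow 3)).mul ((Real.continuous_exp.tendsto _).comp hw.abs)
    simpa using h1
  have hmain : Tendsto (fun t => (x + t * y t) ^ 2 / 2 + y t) (𝓝[>] 0) (𝓝 (x ^ 2 / 2 + y₀)) :=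
    ((hu.pow 2).div_const 2).add hy
  rw [← sub_zero (x ^ 2 / 2 + y₀)]
  refine (hmain.sub (squeeze_zero_norm' (a := fun t => t * |x + t * y t| ^ 3 *
    Real.exp |t * (x + t * y t)|) (f := fun t => ((x + t * y t) ^ 2 / 2 + y t)
      - (Real.exp (t * x + t ^ 2 * y t) - 1 - t * x) / t ^ 2) ?_ hbound)).congr fun t => by ring
  filter_upwards [self_mem_nhdsWithin] with t (ht0 : 0 < t)
  have h := abs_exp_sub_one_sub_id_sub_sq_le (t * (x + t * y t))
  have e : ((x + t * y t) ^ 2 / 2 + y t) - (Real.exp (t * x + t ^ 2 * y t) - 1 - t * x) / t ^ 2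
      = -(Real.exp (t * (x + t * y t)) - 1 - t * (x + t * y t) - (t * (x + t * y t)) ^ 2 / 2)
        / t ^ 2 := by
    rw [show t * x + t ^ 2 * y t = t * (x + t * y t) by ring]
    field_simp
    ring
  rw [e, Real.norm_eq_abs, abs_div, abs_neg, abs_of_pos (by positivity : 0 < t ^ 2),
    div_le_iff₀ (by positivity)]
  refine h.trans (le_of_eq ?_)
  rw [abs_mul t, abs_of_pos ht0]
  ring

/-- The logarithm entering the normalising constant of a correlated Gaussian pair. -/
lemma neg_log_one_sub_div_bounds {q : ℝ} (hq : 0 < q) (hq1 : q < 1) :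
    1 ≤ -Real.log (1 - q) / q ∧ -Real.log (1 - q) / q ≤ 1 / (1 - q) := by
  have h1 : 0 < 1 - q := by linarith
  constructor
  · rw [le_div_iff₀ hq]
    have := Real.log_le_sub_one_of_pos h1
    linarith
  · rw [div_le_div_iff₀ hq h1]
    have h2 := Real.log_le_sub_one_of_pos (inv_pos.2 h1)
    rw [Real.log_inv] at h2
    have h3 : ((1 - q)⁻¹ - 1) * (1 - q) = q := by field_simp; ring
    nlinarith

lemma tendsto_neg_log_one_sub_sq_div :
    Tendsto (fun t : ℝ => -Real.log (1 - t ^ 2) / t ^ 2) (𝓝[>] 0) (𝓝 1) := by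
  have hr : Tendsto (fun t : ℝ => 1 / (1 - t ^ 2)) (𝓝[>] 0) (𝓝 1) := by
    have : ContinuousAt (fun t : ℝ => 1 / (1 - t ^ 2)) 0 := by
      apply ContinuousAt.div <;> first | fun_prop | norm_num
    have h := this.tendsto
    norm_num at h
    simpa using h.mono_left nhdsWithin_le_nhds
  have hmem : ∀ᶠ t : ℝ in 𝓝[>] 0, 0 < t ^ 2 ∧ t ^ 2 < 1 := by
    have : Set.Ioo (0 : ℝ) 1 ∈ 𝓝[>] (0 : ℝ) := Ioo_mem_nhdsGT one_pos
    filter_upwards [this] with t ht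
    exact ⟨pow_pos ht.1 2, by nlinarith [ht.1, ht.2]⟩
  refine tendsto_of_tendsto_of_tendsto_of_le_of_le' tendsto_const_nhds hr ?_ ?_
  · filter_upwards [hmem] with t ht using (neg_log_one_sub_div_bounds ht.1 ht.2).1
  · filter_upwards [hmem] with t ht using (neg_log_one_sub_div_bounds ht.1 ht.2).2

end Scalar

/-! ### Functions of subgaussian growth -/

section Tame

variable {n : ℕ}

lemma affineDensity_nonneg (a : Cn n) {s : ℝ} (hs : 0 < s) (y : Cn n) :
    0 ≤ affineDensity a s y := by unfold affineDensity; positivity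

@[fun_prop]
lemma measurable_affineDensity (a : Cn n) (s : ℝ) : Measurable (affineDensity a s) := by
  unfold affineDensity; fun_prop

lemma integrable_comp_affine_iff (a : Cn n) {s : ℝ} (hs : 0 < s) {h : Cn n → ℝ}
    (hh : Measurable h) :
    Integrable (fun v => h (a + s • v)) (stdGaussian n) ↔
      Integrable (fun y => affineDensity a s y * h y) (stdGaussian n) := by
  have h1 := integrable_map_measure (μ := stdGaussian n) (f := fun v => a + s • v) (g := h)
    hh.aestronglyMeasurable (by fun_prop)
  rw [map_add_smul_stdGaussian a hs] at h1
  rw [show (fun v => h (a + s • v)) = h ∘ fun v => a + s • v from rfl, ← h1,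
    integrable_withDensity_iff (measurable_affineDensity a s).ennreal_ofReal
      (Filter.Eventually.of_forall fun _ => ENNReal.ofReal_lt_top)]
  refine integrable_congr (Filter.Eventually.of_forall fun y => ?_)
  show h y * (ENNReal.ofReal (affineDensity a s y)).toReal = _
  rw [ENNReal.toReal_ofReal (affineDensity_nonneg a hs y), mul_comm]

lemma integral_comp_affine (a : Cn n) {s : ℝ} (hs : 0 < s) {h : Cn n → ℝ} (hh : Measurable h) :
    ∫ v, h (a + s • v) ∂stdGaussian n = ∫ y, affineDensity a s y * h y ∂stdGaussian n := by
  have h1 := integral_map (μ := stdGaussian n) (φ := fun v => a + s • v) (f := h)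
    (by fun_prop) hh.aestronglyMeasurable
  rw [← h1, map_add_smul_stdGaussian a hs,
    integral_withDensity_eq_integral_toReal_smul (measurable_affineDensity a s).ennreal_ofReal
      (Filter.Eventually.of_forall fun _ => ENNReal.ofReal_lt_top)]
  refine integral_congr_ae (Filter.Eventually.of_forall fun y => ?_)
  simp only [smul_eq_mul]
  rw [ENNReal.toReal_ofReal (affineDensity_nonneg a hs y)]

lemma integrable_exp_mul_norm_sq {κ : ℝ} (hκ : κ < 1) :
    Integrable (fun w : Cn n => Real.exp (κ * ‖w‖ ^ 2)) (stdGaussian n) := by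
  -- the dilation by `s = (1 - κ) ^ (-1/2)` has density proportional to this function
  have hpos : 0 < 1 - κ := by linarith
  set s : ℝ := (Real.sqrt (1 - κ))⁻¹ with hs
  have hs0 : 0 < s := by positivity
  have h := (integrable_comp_affine_iff (0 : Cn n) hs0 (h := fun _ => 1) measurable_const).1
    (integrable_const 1)
  have h2 := h.const_mul (s ^ (2 * n))
  refine h2.congr (Filter.Eventually.of_forall fun w => ?_)
  simp only [affineDensity, sub_zero, mul_one]
  rw [← mul_assoc, mul_inv_cancel₀ (by positivity), one_mul]
  congr 1
  rw [hs, inv_pow, Real.sq_sqrt hpos.le, div_inv_eq_mul]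
  ring

/-- Measurable functions whose square stays integrable against `e^{-δ|w|²}` for every `δ > 0`.
This is the integrability that the growth class provides, phrased with the weight
`e^{κ|w|²} dγ`, where `κ = 1 - δ`. -/
structure Tame (φ : Cn n → ℝ) : Prop where
  measurable : Measurable φ
  integrable_sq : ∀ κ < 1, Integrable (fun w => φ w ^ 2 * Real.exp (κ * ‖w‖ ^ 2)) (stdGaussian n)

lemma Tame.integrable_mul_exp {φ : Cn n → ℝ} (hφ : Tame φ) {κ : ℝ} (hκ : κ < 1) :
    Integrable (fun w => |φ w| * Real.exp (κ * ‖w‖ ^ 2)) (stdGaussian n) := by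
  have hm := hφ.measurable
  refine ((hφ.integrable_sq κ hκ).add (integrable_exp_mul_norm_sq hκ)).mono'
    (by fun_prop) (Filter.Eventually.of_forall fun w => ?_)
  have : 0 < Real.exp (κ * ‖w‖ ^ 2) := Real.exp_pos _
  rw [Real.norm_eq_abs, abs_of_nonneg (by positivity)]
  simp only [Pi.add_apply]
  have h1 : |φ w| ≤ φ w ^ 2 + 1 := by rw [← sq_abs]; nlinarith [sq_nonneg (|φ w| - 1)]
  nlinarith

lemma Tame.sq_integrable {φ : Cn n → ℝ} (hφ : Tame φ) :
    Integrable (fun w => φ w ^ 2) (stdGaussian n) := by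
  simpa using hφ.integrable_sq 0 one_pos

lemma Tame.integrable {φ : Cn n → ℝ} (hφ : Tame φ) : Integrable φ (stdGaussian n) := by
  have h := hφ.integrable_mul_exp one_pos
  simp only [zero_mul, Real.exp_zero, mul_one] at h
  exact (integrable_norm_iff hφ.measurable.aestronglyMeasurable).1 h

/-- A function dominated by `|φ|` times a subgaussian factor is integrable. -/
lemma Tame.integrable_mul_of_le {φ : Cn n → ℝ} (hφ : Tame φ) {ψ : Cn n → ℂ} {C κ : ℝ}
    (hψm : Measurable ψ) (hκ : κ < 1) (hψ : ∀ w, ‖ψ w‖ ≤ C * Real.exp (κ * ‖w‖ ^ 2)) :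
    Integrable (fun w => (φ w : ℂ) * ψ w) (stdGaussian n) := by
  have hm := hφ.measurable
  refine ((hφ.integrable_mul_exp hκ).const_mul C).mono' (by fun_prop)
    (Filter.Eventually.of_forall fun w => ?_)
  rw [norm_mul, Complex.norm_real, Real.norm_eq_abs]
  nlinarith [hψ w, abs_nonneg (φ w)]

lemma Tame.comp_affine {φ : Cn n → ℝ} (hφ : Tame φ) (a : Cn n) {s : ℝ} (hs : 0 < s) :
    Tame fun v => φ (a + s • v) := by
  have hm := hφ.measurable
  refine ⟨by fun_prop, fun κ hκ => ?_⟩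
  set h : Cn n → ℝ := fun y => φ y ^ 2 * Real.exp (κ * (‖y - a‖ ^ 2 / s ^ 2)) with hh
  have hhm : Measurable h := by fun_prop
  have e : (fun v => φ (a + s • v) ^ 2 * Real.exp (κ * ‖v‖ ^ 2)) = fun v => h (a + s • v) := by
    funext v
    simp only [hh, add_sub_cancel_left, norm_smul, Real.norm_eq_abs, abs_of_pos hs, mul_pow]
    rw [mul_div_cancel_left₀ _ (by positivity)]
  rw [e, integrable_comp_affine_iff a hs hhm]
  -- `|y|² ≤ 2 |y - a|² + 2 |a|²` turns the shifted weight into a centred one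
  set q := (1 - κ) / s ^ 2 with hq
  have hq0 : 0 < q := div_pos (by linarith) (by positivity)
  refine ((hφ.integrable_sq (1 - q / 2) (by linarith)).const_mul
    ((s ^ (2 * n))⁻¹ * Real.exp (q * ‖a‖ ^ 2))).mono' (by fun_prop)
    (Filter.Eventually.of_forall fun y => ?_)
  have hd := affineDensity_nonneg a hs y
  rw [Real.norm_eq_abs, abs_of_nonneg (by positivity)]
  simp only [hh, affineDensity]
  have h1 : ‖y‖ ^ 2 ≤ 2 * ‖y - a‖ ^ 2 + 2 * ‖a‖ ^ 2 := by
    have : ‖y‖ ≤ ‖y - a‖ + ‖a‖ := by simpa using norm_add_le (y - a) a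
    nlinarith [sq_nonneg (‖y - a‖ - ‖a‖), norm_nonneg y, norm_nonneg a, norm_nonneg (y - a)]
  have h2 : Real.exp (‖y‖ ^ 2 - ‖y - a‖ ^ 2 / s ^ 2) * Real.exp (κ * (‖y - a‖ ^ 2 / s ^ 2))
      ≤ Real.exp (q * ‖a‖ ^ 2) * Real.exp ((1 - q / 2) * ‖y‖ ^ 2) := by
    rw [← Real.exp_add, ← Real.exp_add]
    refine Real.exp_le_exp.2 ?_
    have h3 : ‖y - a‖ ^ 2 / s ^ 2 * (1 - κ) = q * ‖y - a‖ ^ 2 := by rw [hq]; ring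
    nlinarith
  calc (s ^ (2 * n))⁻¹ * Real.exp (‖y‖ ^ 2 - ‖y - a‖ ^ 2 / s ^ 2) *
        (φ y ^ 2 * Real.exp (κ * (‖y - a‖ ^ 2 / s ^ 2)))
      = (s ^ (2 * n))⁻¹ * φ y ^ 2 * (Real.exp (‖y‖ ^ 2 - ‖y - a‖ ^ 2 / s ^ 2)
        * Real.exp (κ * (‖y - a‖ ^ 2 / s ^ 2))) := by ring
    _ ≤ (s ^ (2 * n))⁻¹ * φ y ^ 2 *
        (Real.exp (q * ‖a‖ ^ 2) * Real.exp ((1 - q / 2) * ‖y‖ ^ 2)) :=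
        mul_le_mul_of_nonneg_left h2 (by positivity)
    _ = _ := by ring

end Tame

/-! ### Positivity of the Levi form under Gaussian averages -/

section Levi

variable {n : ℕ}

instance : IsProbabilityMeasure angleMeasure := by
  constructor
  simp only [angleMeasure, Measure.smul_apply, Measure.restrict_apply_univ, Real.volume_Ioc,
    sub_zero, smul_eq_mul]
  rw [← ENNReal.ofReal_mul (by positivity), inv_mul_cancel₀ (by positivity), ENNReal.ofReal_one]

lemma integral_angleMeasure (h : ℝ → ℝ) :
    ∫ θ, h θ ∂angleMeasure = (2 * Real.pi)⁻¹ * ∫ θ in (0 : ℝ)..(2 * Real.pi), h θ := by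
  rw [angleMeasure, integral_smul_measure, ENNReal.toReal_ofReal (by positivity), smul_eq_mul,
    intervalIntegral.integral_of_le (by positivity)]

lemma inner_circleMap_smul_re (θ : ℝ) (c u : Cn n) :
    (inner ℂ (circleMap 0 1 θ • c) u).re
      = Real.cos θ * (inner ℂ c u).re + Real.sin θ * (inner ℂ c u).im := by
  rw [inner_smul_left]
  simp only [circleMap, zero_add, Complex.ofReal_one, one_mul, Complex.mul_re,
    Complex.conj_re, Complex.conj_im, Complex.exp_ofReal_mul_I_re, Complex.exp_ofReal_mul_I_im]
  ring

lemma integral_inner_circleMap_smul_re (c u : Cn n) :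
    ∫ θ, (inner ℂ (circleMap 0 1 θ • c) u).re ∂angleMeasure = 0 := by
  simp_rw [inner_circleMap_smul_re, integral_angleMeasure]
  rw [intervalIntegral.integral_add (Continuous.intervalIntegrable (by fun_prop) _ _)
    (Continuous.intervalIntegrable (by fun_prop) _ _)]
  simp

lemma integral_inner_circleMap_smul_re_sq (c u : Cn n) :
    ∫ θ, (inner ℂ (circleMap 0 1 θ • c) u).re ^ 2 ∂angleMeasure = ‖inner ℂ c u‖ ^ 2 / 2 := by
  simp_rw [inner_circleMap_smul_re, integral_angleMeasure]
  set a := (inner ℂ c u).re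
  set b := (inner ℂ c u).im
  have e : ∀ θ : ℝ, (Real.cos θ * a + Real.sin θ * b) ^ 2
      = a ^ 2 * Real.cos θ ^ 2 + b ^ 2 * Real.sin θ ^ 2
        + 2 * a * b * (Real.sin θ * Real.cos θ) := fun θ => by ring
  simp_rw [e]
  rw [intervalIntegral.integral_add (Continuous.intervalIntegrable (by fun_prop) _ _)
    (Continuous.intervalIntegrable (by fun_prop) _ _),
    intervalIntegral.integral_add (Continuous.intervalIntegrable (by fun_prop) _ _)
    (Continuous.intervalIntegrable (by fun_prop) _ _)]
  simp only [intervalIntegral.integral_const_mul, integral_cos_sq, integral_sin_sq,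
    integral_sin_mul_cos₁]
  rw [← Complex.normSq_eq_norm_sq, Complex.normSq_apply]
  simp
  field_simp
  rfl

end Levi

section LeviPos

open Filter Topology
open scoped ComplexOrder

variable {n : ℕ}

/-- Cameron-Martin formula for the circle average of the translates of `γ`. -/
lemma integral_comp_add_circleMap_smul {φ : Cn n → ℝ} (hφ : Measurable φ) (c : Cn n) (t θ : ℝ) :
    ∫ u, φ (u + circleMap 0 1 θ • ((t : ℂ) • c)) ∂stdGaussian n
      = ∫ u, φ u * Real.exp (t * (2 * (inner ℂ (circleMap 0 1 θ • c) u).re)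
          + t ^ 2 * (-‖c‖ ^ 2)) ∂stdGaussian n := by
  have h := integral_comp_affine (circleMap 0 1 θ • ((t : ℂ) • c)) one_pos hφ
  simp only [one_smul] at h
  simp_rw [add_comm _ (circleMap 0 1 θ • ((t : ℂ) • c))]
  rw [h]
  refine integral_congr_ae (Eventually.of_forall fun u => ?_)
  simp only [affineDensity, one_pow, inv_one, one_mul, div_one]
  rw [mul_comm]
  congr 2
  rw [← inner_conj_symm, norm_sub_sq (𝕜 := ℂ), smul_comm, inner_smul_right, norm_smul, norm_smul,
    norm_circleMap_zero]
  simp only [RCLike.re_to_complex, Complex.re_ofReal_mul, Complex.conj_re, Complex.norm_real,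
    Real.norm_eq_abs, mul_pow, sq_abs, abs_one]
  ring

/-- The sub-mean value inequality along complex lines, averaged against `γ`: the form in which
plurisubharmonicity enters the argument. -/
def GaussianSubmean (φ : Cn n → ℝ) : Prop :=
  ∀ c : Cn n, ∫ u, φ u ∂stdGaussian n
    ≤ ∫ θ, ∫ u, φ (u + circleMap 0 1 θ • c) ∂stdGaussian n ∂angleMeasure

lemma abs_inner_circleMap_re_le (θ : ℝ) (c u : Cn n) :
    |(inner ℂ (circleMap 0 1 θ • c) u).re| ≤ ‖c‖ * ‖u‖ := by
  refine (Complex.abs_re_le_norm _).trans ((norm_inner_le_norm _ _).trans (le_of_eq ?_))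
  rw [norm_smul, norm_circleMap_zero, abs_one, one_mul]

lemma one_add_norm_sq_le_exp (u : Cn n) : 1 + ‖u‖ ^ 2 ≤ 3 * Real.exp (1 / 2 * ‖u‖ ^ 2) := by
  have := one_add_le_mul_exp (δ := 1 / 2) (by norm_num) (sq_nonneg ‖u‖)
  norm_num at this ⊢
  exact this

/-- Testing the Levi form of `φ`, averaged against `γ` and integrated by parts, on a vector `c`.
The kernel `|⟨c, u⟩|² - |c|²` is the second order term, at `t = 0`, of the density of the circle
average of the translates `γ(· - t e^{iθ} c)`. -/
lemma integral_mul_levi_nonneg {φ : Cn n → ℝ} (hφ : Tame φ) (hsub : GaussianSubmean φ)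
    (c : Cn n) : 0 ≤ ∫ u, φ u * (‖inner ℂ c u‖ ^ 2 - ‖c‖ ^ 2) ∂stdGaussian n := by
  have hm := hφ.measurable
  set P : Measure (ℝ × Cn n) := angleMeasure.prod (stdGaussian n) with hP
  set X : ℝ × Cn n → ℝ := fun p => 2 * (inner ℂ (circleMap 0 1 p.1 • c) p.2).re with hX
  have hXc : Continuous X := by
    have : Continuous fun p : ℝ × Cn n => circleMap 0 1 p.1 :=
      (continuous_circleMap 0 1).comp continuous_fst
    exact continuous_const.mul (Complex.continuous_re.comp
      ((this.smul continuous_const).inner continuous_snd))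
  have hXm : Measurable X := hXc.measurable
  have hXle : ∀ p, |X p| ≤ 2 * (‖c‖ * ‖p.2‖) := fun p => by
    rw [hX, abs_mul, abs_two]
    exact mul_le_mul_of_nonneg_left (abs_inner_circleMap_re_le _ _ _) (by norm_num)
  set K := ‖c‖ + ‖c‖ ^ 2 with hK
  have hXK : ∀ p, |X p| ≤ K * (1 + ‖p.2‖ ^ 2) := fun p => by
    refine (hXle p).trans ?_
    nlinarith [mul_nonneg (norm_nonneg c) (sq_nonneg (‖p.2‖ - 1)),
      mul_nonneg (sq_nonneg ‖c‖) (sq_nonneg ‖p.2‖), sq_nonneg ‖c‖]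
  have hYK : ∀ p : ℝ × Cn n, |-‖c‖ ^ 2| ≤ K * (1 + ‖p.2‖ ^ 2) := fun p => by
    rw [abs_neg, abs_of_nonneg (by positivity)]
    nlinarith [mul_nonneg (norm_nonneg c) (sq_nonneg ‖p.2‖), norm_nonneg c,
      mul_nonneg (sq_nonneg ‖c‖) (sq_nonneg ‖p.2‖)]
  obtain ⟨C, τ, hC, hτ, hbound⟩ := exists_abs_exp_remainder_le (K := K) (κ := 1 / 2)
    (by positivity) (by norm_num)
  -- a weighted copy of `φ` dominates everything on the product space
  have hD : Integrable (fun p : ℝ × Cn n => |φ p.2| * Real.exp (1 / 2 * ‖p.2‖ ^ 2)) P :=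
    (hφ.integrable_mul_exp (κ := 1 / 2) (by norm_num)).comp_snd angleMeasure
  have hdom : ∀ {h : ℝ × Cn n → ℝ} {B : ℝ}, Measurable h →
      (∀ p, |h p| ≤ B * Real.exp (1 / 2 * ‖p.2‖ ^ 2)) →
      Integrable (fun p => φ p.2 * h p) P := by
    intro h B hh hB
    refine (hD.const_mul B).mono' (by fun_prop) (Eventually.of_forall fun p => ?_)
    rw [Real.norm_eq_abs, abs_mul]
    nlinarith [hB p, abs_nonneg (φ p.2)]
  have hφP : Integrable (fun p : ℝ × Cn n => φ p.2) P := hφ.integrable.comp_snd angleMeasure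
  have hφX : Integrable (fun p => φ p.2 * X p) P := by
    refine hdom (B := K * 3) hXm fun p => (hXK p).trans ?_
    rw [mul_assoc]
    exact mul_le_mul_of_nonneg_left (one_add_norm_sq_le_exp _) (by positivity)
  set Q : ℝ × Cn n → ℝ := fun p => X p ^ 2 / 2 + -‖c‖ ^ 2 with hQ
  have hφQ : Integrable (fun p => φ p.2 * Q p) P := by
    refine hdom (B := 2 * ‖c‖ ^ 2 * 3) (by fun_prop) fun p => ?_
    have h1 : X p ^ 2 ≤ 4 * ‖c‖ ^ 2 * ‖p.2‖ ^ 2 := by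
      rw [← sq_abs]
      calc |X p| ^ 2 ≤ (2 * (‖c‖ * ‖p.2‖)) ^ 2 := pow_le_pow_left₀ (abs_nonneg _) (hXle p) 2
        _ = _ := by ring
    have h2 : |Q p| ≤ 2 * ‖c‖ ^ 2 * (1 + ‖p.2‖ ^ 2) := by
      rw [hQ, abs_le]
      constructor <;> nlinarith [sq_nonneg (X p), sq_nonneg ‖c‖,
        mul_nonneg (sq_nonneg ‖c‖) (sq_nonneg ‖p.2‖)]
    refine h2.trans ?_
    rw [mul_assoc _ (3 : ℝ)]
    exact mul_le_mul_of_nonneg_left (one_add_norm_sq_le_exp _) (by positivity)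
  set R : ℝ → ℝ × Cn n → ℝ := fun t p =>
    (Real.exp (t * X p + t ^ 2 * (-‖c‖ ^ 2)) - 1 - t * X p) / t ^ 2 with hR
  have hRm : ∀ t, Measurable (R t) := fun t => by fun_prop
  have hRle : ∀ t, 0 < t → t ≤ τ → ∀ p, |R t p| ≤ C * Real.exp (1 / 2 * ‖p.2‖ ^ 2) :=
    fun t ht htτ p => hbound t _ _ _ ht htτ (sq_nonneg _) (hXK p) (hYK p)
  have hφR : ∀ t, 0 < t → t ≤ τ → Integrable (fun p => φ p.2 * R t p) P :=
    fun t ht htτ => hdom (hRm t) (hRle t ht htτ)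
  have hmem : Set.Ioc 0 τ ∈ 𝓝[>] (0 : ℝ) := Ioc_mem_nhdsGT hτ
  have hlim : Tendsto (fun t => ∫ p, φ p.2 * R t p ∂P) (𝓝[>] 0) (𝓝 (∫ p, φ p.2 * Q p ∂P)) := by
    refine tendsto_integral_filter_of_dominated_convergence
      (fun p : ℝ × Cn n => C * (|φ p.2| * Real.exp (1 / 2 * ‖p.2‖ ^ 2)))
      (Eventually.of_forall fun t => by fun_prop) ?_ (hD.const_mul C) ?_
    · filter_upwards [hmem] with t ht
      refine Eventually.of_forall fun p => ?_
      rw [Real.norm_eq_abs, abs_mul]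
      nlinarith [hRle t ht.1 ht.2 p, abs_nonneg (φ p.2)]
    · refine Eventually.of_forall fun p => ?_
      exact (tendsto_exp_remainder (X p) tendsto_const_nhds).const_mul _
  have hXzero : ∫ p, φ p.2 * X p ∂P = 0 := by
    rw [hP, integral_prod_symm _ hφX]
    simp only [hX, integral_const_mul, integral_inner_circleMap_smul_re, mul_zero, integral_zero]
  have hpos : ∀ t, 0 < t → t ≤ τ → 0 ≤ ∫ p, φ p.2 * R t p ∂P := by
    intro t ht htτ
    set E : ℝ × Cn n → ℝ := fun p => Real.exp (t * X p + t ^ 2 * (-‖c‖ ^ 2)) with hE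
    have e1 : (fun p => φ p.2 * E p)
        = fun p => φ p.2 + (t * (φ p.2 * X p) + t ^ 2 * (φ p.2 * R t p)) := by
      funext p
      simp only [hE, hR]
      field_simp
      ring
    have hi : Integrable (fun p => t * (φ p.2 * X p) + t ^ 2 * (φ p.2 * R t p)) P :=
      (hφX.const_mul t).add ((hφR t ht htτ).const_mul _)
    have hφE : Integrable (fun p => φ p.2 * E p) P := by
      rw [e1]; exact hφP.add hi
    have e2 : ∫ p, φ p.2 * E p ∂P = ∫ u, φ u ∂stdGaussian n + t ^ 2 * ∫ p, φ p.2 * R t p ∂P := by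
      rw [e1, integral_add hφP hi, integral_add (hφX.const_mul t) ((hφR t ht htτ).const_mul _),
        integral_const_mul, integral_const_mul, hXzero, hP, integral_fun_snd (fun u => φ u)]
      simp
    have e3 : ∫ u, φ u ∂stdGaussian n ≤ ∫ p, φ p.2 * E p ∂P := by
      rw [hP, integral_prod _ hφE]
      refine (hsub ((t : ℂ) • c)).trans (le_of_eq ?_)
      simp_rw [integral_comp_add_circleMap_smul hm c t, hE, hX]
    have h4 : 0 ≤ t ^ 2 * ∫ p, φ p.2 * R t p ∂P := by linarith
    exact nonneg_of_mul_nonneg_right h4 (by positivity)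
  have hfin : 0 ≤ ∫ p, φ p.2 * Q p ∂P := by
    refine ge_of_tendsto hlim ?_
    filter_upwards [hmem] with t ht using hpos t ht.1 ht.2
  refine hfin.trans (le_of_eq ?_)
  rw [hP, integral_prod_symm _ hφQ]
  refine integral_congr_ae (Eventually.of_forall fun u => ?_)
  simp only [hQ, hX, integral_const_mul]
  congr 1
  have hci : Integrable (fun θ => (inner ℂ (circleMap 0 1 θ • c) u).re ^ 2) angleMeasure := by
    refine Integrable.of_bound (C := (‖c‖ * ‖u‖) ^ 2) ?_ (Eventually.of_forall fun θ => ?_)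
    · have : Continuous fun θ : ℝ => (inner ℂ (circleMap 0 1 θ • c) u).re ^ 2 :=
        (Complex.continuous_re.comp (((continuous_circleMap 0 1).smul continuous_const).inner
          continuous_const)).pow 2
      exact this.aestronglyMeasurable
    · rw [Real.norm_eq_abs, abs_pow]
      exact pow_le_pow_left₀ (abs_nonneg _) (abs_inner_circleMap_re_le _ _ _) 2
  have e : (fun θ => (2 * (inner ℂ (circleMap 0 1 θ • c) u).re) ^ 2 / 2 + -‖c‖ ^ 2)
      = fun θ => 2 * (inner ℂ (circleMap 0 1 θ • c) u).re ^ 2 + -‖c‖ ^ 2 := by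
    funext θ; ring
  rw [e, integral_add (hci.const_mul 2) (integrable_const _), integral_const_mul,
    integral_inner_circleMap_smul_re_sq]
  simp
  ring

/-- The Levi matrix of `φ` averaged against `γ`, with the derivatives moved onto the Gaussian
density. -/
noncomputable def leviMatrix (φ : Cn n → ℝ) : Matrix (Fin n) (Fin n) ℂ :=
  fun j k => ∫ u, (φ u : ℂ) * (u j * starRingEnd ℂ (u k) - (1 : Matrix (Fin n) (Fin n) ℂ) j k)
    ∂stdGaussian n

lemma Tame.integrable_leviMatrix {φ : Cn n → ℝ} (hφ : Tame φ) (j k : Fin n) :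
    Integrable (fun u : Cn n => (φ u : ℂ) *
      (u j * starRingEnd ℂ (u k) - (1 : Matrix (Fin n) (Fin n) ℂ) j k)) (stdGaussian n) := by
  refine hφ.integrable_mul_of_le (C := 3) (κ := 1 / 2) ?_ (by norm_num) fun w => ?_
  · have : Continuous fun u : Cn n =>
        u j * starRingEnd ℂ (u k) - (1 : Matrix (Fin n) (Fin n) ℂ) j k := by fun_prop
    exact this.measurable
  · refine le_trans ?_ (one_add_norm_sq_le_exp w)
    refine (norm_sub_le _ _).trans ?_
    have h1 : ‖w j * starRingEnd ℂ (w k)‖ ≤ ‖w‖ ^ 2 := by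
      rw [norm_mul, RCLike.norm_conj, sq]
      exact mul_le_mul (PiLp.norm_apply_le w j) (PiLp.norm_apply_le w k) (norm_nonneg _)
        (norm_nonneg _)
    have h2 : ‖(1 : Matrix (Fin n) (Fin n) ℂ) j k‖ ≤ 1 := by
      rw [Matrix.one_apply]; split_ifs <;> simp
    linarith

lemma leviMatrix_posSemidef {φ : Cn n → ℝ} (hφ : Tame φ) (hsub : GaussianSubmean φ) :
    (leviMatrix φ).PosSemidef := by
  rw [Matrix.posSemidef_iff_dotProduct_mulVec]
  constructor
  · ext j k
    rw [Matrix.conjTranspose_apply, leviMatrix, leviMatrix, RCLike.star_def, ← integral_conj]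
    refine integral_congr_ae (Eventually.of_forall fun u => ?_)
    simp only [map_mul, map_sub, Complex.conj_ofReal, Complex.conj_conj]
    rw [mul_comm (starRingEnd ℂ (u k)), Matrix.one_apply, Matrix.one_apply]
    simp only [eq_comm (a := k), apply_ite (starRingEnd ℂ), map_one, map_zero]
  · intro x
    set c : Cn n := WithLp.toLp 2 x with hc
    have key : star x ⬝ᵥ (leviMatrix φ).mulVec x
        = ((∫ u, φ u * (‖inner ℂ c u‖ ^ 2 - ‖c‖ ^ 2) ∂stdGaussian n : ℝ) : ℂ) := by
      rw [← integral_complex_ofReal]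
      simp only [dotProduct, Matrix.mulVec, leviMatrix]
      simp_rw [← integral_mul_const, Finset.mul_sum, ← integral_const_mul]
      have hint : ∀ j k, Integrable (fun u : Cn n => star x j * ((φ u : ℂ) * (u j *
          starRingEnd ℂ (u k) - (1 : Matrix (Fin n) (Fin n) ℂ) j k) * x k)) (stdGaussian n) :=
        fun j k => ((hφ.integrable_leviMatrix j k).mul_const _).const_mul _
      simp_rw [← integral_finsetSum _ (fun k _ => hint _ k)]
      rw [← integral_finsetSum _ (fun j _ => integrable_finsetSum _ (fun k _ => hint j k))]
      refine integral_congr_ae (Eventually.of_forall fun u => ?_)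
      have h1 : ((‖inner ℂ c u‖ ^ 2 : ℝ) : ℂ)
          = ∑ j, ∑ k, star x j * (u j * starRingEnd ℂ (u k)) * x k := by
        rw [← Complex.normSq_eq_norm_sq, ← Complex.mul_conj]
        simp only [hc, PiLp.inner_apply, RCLike.inner_apply, map_sum, map_mul, Complex.conj_conj]
        rw [Finset.sum_mul_sum]
        refine Finset.sum_congr rfl fun j _ => Finset.sum_congr rfl fun k _ => ?_
        simp only [Pi.star_apply, RCLike.star_def]
        ring
      have h2 : ((‖c‖ ^ 2 : ℝ) : ℂ)
          = ∑ j, ∑ k, star x j * (1 : Matrix (Fin n) (Fin n) ℂ) j k * x k := by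
        rw [EuclideanSpace.norm_sq_eq]
        simp only [hc, Matrix.one_apply, mul_ite, mul_one, mul_zero, ite_mul, zero_mul,
          Finset.sum_ite_eq, Finset.mem_univ, if_true]
        push_cast
        refine Finset.sum_congr rfl fun j _ => ?_
        simp [Complex.conj_mul']
      simp only
      push_cast at h1 h2 ⊢
      rw [h1, h2, ← Finset.sum_sub_distrib, Finset.mul_sum]
      refine Finset.sum_congr rfl fun j _ => ?_
      rw [← Finset.sum_sub_distrib, Finset.mul_sum]
      refine Finset.sum_congr rfl fun k _ => ?_
      ring
    rw [key]
    exact_mod_cast integral_mul_levi_nonneg hφ hsub c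

lemma trace_mul_nonneg_of_posSemidef {A B : Matrix (Fin n) (Fin n) ℂ} (hA : A.PosSemidef)
    (hB : B.PosSemidef) : 0 ≤ (A * B).trace := by
  obtain ⟨m, v, rfl⟩ := Matrix.posSemidef_iff_eq_sum_vecMulVec.1 hA
  rw [Finset.sum_mul, Matrix.trace_sum]
  refine Finset.sum_nonneg fun i _ => ?_
  rw [Matrix.vecMulVec_mul, Matrix.trace_vecMulVec, dotProduct_comm, ← Matrix.dotProduct_mulVec]
  exact (Matrix.posSemidef_iff_dotProduct_mulVec.1 hB).2 _

/-- The value at `ρ = 0` of `∂²/∂ρ∂ρ̄` of the density, relative to `γ ⊗ γ`, of a pair of Gaussian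
vectors with complex correlation `ρ`. -/
noncomputable def correlationKernel (u v : Cn n) : ℝ :=
  ‖inner ℂ u v‖ ^ 2 - ‖u‖ ^ 2 - ‖v‖ ^ 2 + n

/-- The kernel is the trace pairing of the two matrices whose averages are Levi matrices. -/
lemma correlationKernel_eq_sum (u v : Cn n) : (correlationKernel u v : ℂ)
    = ∑ j, ∑ k, (u j * starRingEnd ℂ (u k) - (1 : Matrix (Fin n) (Fin n) ℂ) j k)
      * (v k * starRingEnd ℂ (v j) - (1 : Matrix (Fin n) (Fin n) ℂ) k j) := by
  have h1 : ((‖inner ℂ u v‖ ^ 2 : ℝ) : ℂ)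
      = ∑ j, ∑ k, (u j * starRingEnd ℂ (u k)) * (v k * starRingEnd ℂ (v j)) := by
    rw [← Complex.normSq_eq_norm_sq, ← Complex.mul_conj, mul_comm]
    simp only [PiLp.inner_apply, RCLike.inner_apply, map_sum, map_mul, Complex.conj_conj]
    rw [Finset.sum_mul_sum]
    refine Finset.sum_congr rfl fun j _ => Finset.sum_congr rfl fun k _ => ?_
    ring
  have h2 : ∀ w : Cn n, ((‖w‖ ^ 2 : ℝ) : ℂ) = ∑ j, w j * starRingEnd ℂ (w j) := by
    intro w
    rw [EuclideanSpace.norm_sq_eq]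
    push_cast
    exact Finset.sum_congr rfl fun j _ => by simp [Complex.mul_conj']
  have e : (correlationKernel u v : ℂ) = ((‖inner ℂ u v‖ ^ 2 : ℝ) : ℂ) - ((‖u‖ ^ 2 : ℝ) : ℂ)
      - ((‖v‖ ^ 2 : ℝ) : ℂ) + n := by
    simp only [correlationKernel]; push_cast; ring
  rw [e, h1, h2, h2]
  simp only [sub_mul, mul_sub, Finset.sum_sub_distrib, Matrix.one_apply, mul_ite, mul_one, mul_zero,
    ite_mul, one_mul, zero_mul, Finset.sum_ite_eq, Finset.sum_ite_eq', Finset.mem_univ, if_true,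
    Finset.sum_const, Finset.card_univ, Fintype.card_fin]
  simp
  ring

/-- The pairing of `φ ⊗ ψ` with the correlation kernel is the trace of the product of two positive
semidefinite matrices. -/
lemma integral_mul_mul_correlationKernel_nonneg {φ ψ : Cn n → ℝ} (hφ : Tame φ) (hψ : Tame ψ)
    (hφs : GaussianSubmean φ) (hψs : GaussianSubmean ψ) :
    0 ≤ ∫ p : Cn n × Cn n, φ p.1 * ψ p.2 * correlationKernel p.1 p.2
      ∂(stdGaussian n).prod (stdGaussian n) := by
  have h0 := trace_mul_nonneg_of_posSemidef (leviMatrix_posSemidef hφ hφs)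
    (leviMatrix_posSemidef hψ hψs)
  have key : (leviMatrix φ * leviMatrix ψ).trace
      = ((∫ p : Cn n × Cn n, φ p.1 * ψ p.2 * correlationKernel p.1 p.2
      ∂(stdGaussian n).prod (stdGaussian n) : ℝ) : ℂ) := by
    rw [← integral_complex_ofReal]
    simp only [Matrix.trace, Matrix.diag, Matrix.mul_apply, leviMatrix]
    simp_rw [← integral_prod_mul]
    have hint := fun j k => (hφ.integrable_leviMatrix j k).mul_prod (hψ.integrable_leviMatrix k j)
    simp_rw [← integral_finsetSum _ (fun k _ => hint _ k)]
    rw [← integral_finsetSum _ (fun j _ => integrable_finsetSum _ (fun k _ => hint j k))]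
    refine integral_congr_ae (Eventually.of_forall fun p => ?_)
    simp only [Complex.ofReal_mul]
    rw [correlationKernel_eq_sum, Finset.mul_sum]
    refine Finset.sum_congr rfl fun j _ => ?_
    rw [Finset.mul_sum]
    refine Finset.sum_congr rfl fun k _ => ?_
    ring
  rw [key] at h0
  exact_mod_cast h0

end LeviPos

/-! ### Correlated Gaussian pairs -/

section Correlation

open Filter Topology Complex

variable {n : ℕ}

/-- The expectation of `f(X) g(Y)` for a pair of standard complex Gaussian vectors with
`E[Y_j conj(X_k)] = ρ δ_{jk}`, where `|ρ| ≤ 1`. -/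
noncomputable def corr (f g : Cn n → ℝ) (ρ : ℂ) : ℝ :=
  ∫ p : Cn n × Cn n, f p.1 * g (ρ • p.1 + Real.sqrt (1 - normSq ρ) • p.2)
    ∂(stdGaussian n).prod (stdGaussian n)

lemma corr_zero (f g : Cn n → ℝ) :
    corr f g 0 = (∫ x, f x ∂stdGaussian n) * ∫ y, g y ∂stdGaussian n := by
  simp [corr, integral_prod_mul]

lemma corr_one (f g : Cn n → ℝ) : corr f g 1 = ∫ x, f x * g x ∂stdGaussian n := by
  have h := integral_fun_fst (μ := stdGaussian n) (ν := stdGaussian n) (fun x => f x * g x)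
  simp only [corr, normSq_one, sub_self, Real.sqrt_zero, zero_smul, add_zero, one_smul]
  rw [h]; simp

lemma measurePreserving_corr {ρ : ℂ} (hρ : normSq ρ ≤ 1) :
    MeasurePreserving (fun p : Cn n × Cn n => ρ • p.1 + Real.sqrt (1 - normSq ρ) • p.2)
      ((stdGaussian n).prod (stdGaussian n)) (stdGaussian n) := by
  have h := measurePreserving_smul_add_smul (n := n) (α := ρ)
    (β := (Real.sqrt (1 - normSq ρ) : ℝ)) (by
      rw [normSq_ofReal, Real.mul_self_sqrt (by linarith)]; ring)
  simpa only [Complex.coe_smul] using h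

/-- Rotating `X` shows that only the modulus of the correlation matters if `f` is circular. -/
lemma corr_eq_corr_norm {f g : Cn n → ℝ} (hf : Measurable f) (hg : Measurable g)
    (hsymm : ∀ (ω : ℂ) (w : Cn n), ‖ω‖ = 1 → f (ω • w) = f w) (ρ : ℂ) :
    corr f g ρ = corr f g (‖ρ‖ : ℝ) := by
  obtain ⟨ω, hω, hρ⟩ : ∃ ω : ℂ, ‖ω‖ = 1 ∧ ρ = ‖ρ‖ * ω := by
    refine ⟨exp (arg ρ * I), norm_exp_ofReal_mul_I _, ?_⟩
    exact (norm_mul_exp_arg_mul_I ρ).symm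
  have hns : normSq ω = 1 := by rw [normSq_eq_norm_sq, hω]; norm_num
  have hmp : MeasurePreserving (fun p : Cn n × Cn n => (ω • p.1, p.2))
      ((stdGaussian n).prod (stdGaussian n)) ((stdGaussian n).prod (stdGaussian n)) :=
    (measurePreserving_smul hns).prod (MeasurePreserving.id _)
  have e : normSq ((‖ρ‖ : ℝ) : ℂ) = normSq ρ := by
    rw [normSq_ofReal, normSq_eq_norm_sq, sq]
  simp only [corr, e]
  conv_rhs => rw [← hmp.map_eq]
  rw [integral_map hmp.measurable.aemeasurable (Measurable.aestronglyMeasurable (by fun_prop))]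
  refine integral_congr_ae (Eventually.of_forall fun p => ?_)
  simp only
  rw [hsymm ω _ hω, smul_smul, ← hρ]

/-- A pair with correlation `r + (1 - r) t ω` is split into a common component `z` and a pair with
correlation `t ω`, with weights `√r` and `√(1 - r)`. -/
lemma integral_corr_split {r t : ℝ} (hr0 : 0 ≤ r) (hr1 : r ≤ 1) (ht0 : 0 ≤ t) (ht1 : t ≤ 1)
    {ω : ℂ} (hω : normSq ω = 1) {h : Cn n × Cn n → ℝ} (hh : Measurable h) :
    let ρ : ℂ := r + (1 - r) * t * ω
    let T : Cn n × Cn n × Cn n → Cn n × Cn n := fun p =>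
      (Real.sqrt r • p.1 + Real.sqrt (1 - r) • p.2.1,
        Real.sqrt r • p.1 + Real.sqrt (1 - r) •
          (((t : ℂ) * ω) • p.2.1 + Real.sqrt (1 - t ^ 2) • p.2.2))
    normSq ρ ≤ 1 ∧
    MeasurePreserving T ((stdGaussian n).prod ((stdGaussian n).prod (stdGaussian n)))
      (((stdGaussian n).prod (stdGaussian n)).map
        fun p => (p.1, ρ • p.1 + Real.sqrt (1 - normSq ρ) • p.2)) ∧
    ∫ p : Cn n × Cn n, h (p.1, ρ • p.1 + Real.sqrt (1 - normSq ρ) • p.2)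
      ∂(stdGaussian n).prod (stdGaussian n)
    = ∫ p, h (T p) ∂(stdGaussian n).prod ((stdGaussian n).prod (stdGaussian n)) := by
  intro ρ T
  have hρ : normSq ρ ≤ 1 := by
    have hn : ‖ω‖ = 1 := by
      have := normSq_eq_norm_sq ω
      rw [hω] at this
      nlinarith [norm_nonneg ω]
    have h1 : ‖ρ‖ ≤ 1 := by
      calc ‖ρ‖ ≤ ‖(r : ℂ)‖ + ‖((1 - r) * t * ω : ℂ)‖ := norm_add_le _ _
        _ = r + (1 - r) * t := by
          rw [norm_mul, hn, mul_one, show ((1 : ℂ) - r) * t = (((1 - r) * t : ℝ) : ℂ) by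
            push_cast; ring, norm_real, norm_real, Real.norm_of_nonneg hr0,
            Real.norm_of_nonneg (by nlinarith)]
        _ ≤ 1 := by nlinarith
    rw [normSq_eq_norm_sq]
    nlinarith [norm_nonneg ρ]
  have h1r : 0 ≤ 1 - r := by linarith
  have h1t : 0 ≤ 1 - t ^ 2 := by nlinarith
  have key := map_pair_eq_of_gram (n := n)
    (a := ![(Real.sqrt r : ℝ), (Real.sqrt (1 - r) : ℝ), 0])
    (b := ![(Real.sqrt r : ℝ), (Real.sqrt (1 - r) : ℝ) * ((t : ℂ) * ω),
      (Real.sqrt (1 - r) : ℝ) * (Real.sqrt (1 - t ^ 2) : ℝ)])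
    (a' := ![1, 0, 0])
    (b' := ![ρ, (Real.sqrt (1 - normSq ρ) : ℝ), 0])
    (by
      simp only [Fin.sum_univ_three, Matrix.cons_val_zero, Matrix.cons_val_one, Matrix.cons_val,
        normSq_ofReal, Real.mul_self_sqrt hr0, Real.mul_self_sqrt h1r, map_zero, map_one]
      ring)
    (by
      simp only [Fin.sum_univ_three, Matrix.cons_val_zero, Matrix.cons_val_one, Matrix.cons_val,
        map_mul, normSq_ofReal, Real.mul_self_sqrt hr0, Real.mul_self_sqrt h1r,
        Real.mul_self_sqrt h1t, hω, map_zero,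
        Real.mul_self_sqrt (show 0 ≤ 1 - normSq ρ by linarith)]
      ring)
    (by
      have e1 : ((Real.sqrt r : ℝ) : ℂ) * (Real.sqrt r : ℝ) = r := by
        rw [← ofReal_mul, Real.mul_self_sqrt hr0]
      have e2 : ((Real.sqrt (1 - r) : ℝ) : ℂ) * (Real.sqrt (1 - r) : ℝ) = 1 - r := by
        rw [← ofReal_mul, Real.mul_self_sqrt h1r]; push_cast; ring
      simp only [Fin.sum_univ_three, Matrix.cons_val_zero, Matrix.cons_val_one, Matrix.cons_val,
        map_mul, conj_ofReal, zero_mul, add_zero, one_mul, e1, ← mul_assoc, e2]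
      simp only [ρ, map_add, map_mul, conj_ofReal, map_sub, map_one])
  simp only [Matrix.cons_val_zero, Matrix.cons_val_one, Matrix.cons_val, zero_smul, add_zero,
    one_smul, mul_smul, Complex.coe_smul] at key
  have hTm : Measurable T := by fun_prop
  have eT : (fun p : Cn n × Cn n × Cn n =>
      (Real.sqrt r • p.1 + Real.sqrt (1 - r) • p.2.1,
        Real.sqrt r • p.1 + Real.sqrt (1 - r) • t • ω • p.2.1 +
          Real.sqrt (1 - r) • Real.sqrt (1 - t ^ 2) • p.2.2)) = T := by
    funext p
    simp only [T, smul_add, mul_smul, Complex.coe_smul, add_assoc]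
  rw [eT] at key
  have hmap : Measure.map T ((stdGaussian n).prod ((stdGaussian n).prod (stdGaussian n)))
      = ((stdGaussian n).prod (stdGaussian n)).map
        fun p => (p.1, ρ • p.1 + Real.sqrt (1 - normSq ρ) • p.2) := by
    rw [key]
    conv_rhs => rw [← measurePreserving_fst_snd_fst.map_eq]
    rw [Measure.map_map (by fun_prop) (by fun_prop)]
    rfl
  refine ⟨hρ, ⟨hTm, hmap⟩, ?_⟩
  rw [← integral_map (φ := T) hTm.aemeasurable hh.aestronglyMeasurable, hmap,
    integral_map (by fun_prop) hh.aestronglyMeasurable]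

/-- Joint integrability, with a Gaussian weight to spare, after mixing with an independent
component: a rotation of the pair reduces it to the weight `e^{(|x|² + |y|²)/2}`. -/
lemma Tame.integrable_mix {φ : Cn n → ℝ} (hφ : Tame φ) {r : ℝ} (hr0 : 0 ≤ r) (hr1 : r ≤ 1) :
    Integrable (fun p : Cn n × Cn n => φ (Real.sqrt r • p.1 + Real.sqrt (1 - r) • p.2) ^ 2
      * Real.exp (1 / 2 * ‖p.2‖ ^ 2)) ((stdGaussian n).prod (stdGaussian n)) := by
  have h1r : 0 ≤ 1 - r := by linarith
  have hrot := measurePreserving_rotation (n := n) (α := (Real.sqrt r : ℝ))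
    (β := (Real.sqrt (1 - r) : ℝ)) (by
      rw [normSq_ofReal, normSq_ofReal, Real.mul_self_sqrt hr0, Real.mul_self_sqrt h1r]; ring)
  have h := (hφ.integrable_sq (1 / 2) (by norm_num)).mul_prod
    (integrable_exp_mul_norm_sq (n := n) (κ := 1 / 2) (by norm_num))
  have h2 := hrot.integrable_comp_of_integrable h
  have hm := hφ.measurable
  refine h2.mono' (by fun_prop) (Eventually.of_forall fun p => ?_)
  rw [Real.norm_eq_abs, abs_of_nonneg (by positivity)]
  simp only [Function.comp_def, conj_ofReal, Complex.coe_smul, mul_assoc, ← Real.exp_add]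
  refine mul_le_mul_of_nonneg_left (Real.exp_le_exp.2 ?_) (sq_nonneg _)
  rw [← ofReal_neg, Complex.coe_smul]
  -- the rotation preserves `‖p.1‖² + ‖p.2‖²`
  have e : ‖Real.sqrt r • p.1 + Real.sqrt (1 - r) • p.2‖ ^ 2
      + ‖(-Real.sqrt (1 - r)) • p.1 + Real.sqrt r • p.2‖ ^ 2 = ‖p.1‖ ^ 2 + ‖p.2‖ ^ 2 := by
    rw [norm_add_sq_real, norm_add_sq_real]
    simp only [norm_smul, mul_pow, Real.norm_eq_abs, sq_abs, inner_smul_left, inner_smul_right,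
      neg_sq, Real.sq_sqrt hr0, Real.sq_sqrt h1r, conj_trivial]
    ring
  nlinarith [sq_nonneg ‖p.1‖]

/-- Bound for the coefficient of `t` in the exponent of the density of a pair with correlation
`t ω`. -/
lemma abs_two_mul_inner_re_le {ω : ℂ} (hω : normSq ω = 1) (u v : Cn n) :
    |2 * (inner ℂ (ω • u) v).re| ≤ ‖u‖ ^ 2 + ‖v‖ ^ 2 := by
  have hn : ‖ω‖ = 1 := by
    have := normSq_eq_norm_sq ω
    rw [hω] at this
    nlinarith [norm_nonneg ω]
  have h1 : |(inner ℂ (ω • u) v).re| ≤ ‖u‖ * ‖v‖ := by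
    refine (Complex.abs_re_le_norm _).trans ((norm_inner_le_norm _ _).trans (le_of_eq ?_))
    rw [norm_smul, hn, one_mul]
  rw [abs_mul, abs_two]
  nlinarith [sq_nonneg (‖u‖ - ‖v‖)]

/-- The coefficient of `t²` in the exponent of the density of a pair with correlation `t ω`. -/
noncomputable def quadCoeff (ω : ℂ) (u v : Cn n) (t : ℝ) : ℝ :=
  n * (-Real.log (1 - t ^ 2) / t ^ 2) - (‖u‖ ^ 2 + ‖v‖ ^ 2) / (1 - t ^ 2)
    + t * (2 * (inner ℂ (ω • u) v).re) / (1 - t ^ 2)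

lemma affineDensity_eq_exp {ω : ℂ} (hω : normSq ω = 1) (u v : Cn n) {t : ℝ} (ht0 : 0 < t)
    (ht1 : t < 1) : affineDensity (((t : ℂ) * ω) • u) (Real.sqrt (1 - t ^ 2)) v
      = Real.exp (t * (2 * (inner ℂ (ω • u) v).re) + t ^ 2 * quadCoeff ω u v t) := by
  have h1 : 0 < 1 - t ^ 2 := by nlinarith
  have e : ‖v - ((t : ℂ) * ω) • u‖ ^ 2
      = ‖v‖ ^ 2 - t * (2 * (inner ℂ (ω • u) v).re) + t ^ 2 * ‖u‖ ^ 2 := by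
    rw [norm_sub_sq (𝕜 := ℂ), ← inner_conj_symm, mul_smul, inner_smul_left, norm_smul, norm_smul,
      mul_pow, mul_pow, ← normSq_eq_norm_sq ω, hω]
    simp only [RCLike.re_to_complex, conj_re, conj_ofReal, re_ofReal_mul, norm_real,
      Real.norm_eq_abs, sq_abs]
    ring
  rw [affineDensity, pow_mul, Real.sq_sqrt h1.le, e]
  have e2 : ((1 - t ^ 2) ^ n)⁻¹ = Real.exp (t ^ 2 * (n * (-Real.log (1 - t ^ 2) / t ^ 2))) := by
    rw [show t ^ 2 * (n * (-Real.log (1 - t ^ 2) / t ^ 2)) = -(n * Real.log (1 - t ^ 2)) by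
      field_simp, Real.exp_neg, ← Real.log_pow, Real.exp_log (by positivity)]
  rw [e2, ← Real.exp_add]
  congr 1
  rw [quadCoeff]
  field_simp
  ring

lemma abs_quadCoeff_le {ω : ℂ} (hω : normSq ω = 1) (u v : Cn n) {t : ℝ} (ht0 : 0 < t)
    (ht1 : t ≤ 1 / 2) : |quadCoeff ω u v t| ≤ (2 * n + 4) * (1 + (‖u‖ ^ 2 + ‖v‖ ^ 2)) := by
  have hq : t ^ 2 ≤ 1 / 2 := by nlinarith
  have hq0 : 0 < t ^ 2 := by positivity
  have hinv : 1 / (1 - t ^ 2) ≤ 2 := by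
    rw [div_le_iff₀ (by linarith)]; linarith
  have hinv0 : 0 < 1 / (1 - t ^ 2) := by apply div_pos <;> linarith
  obtain ⟨l1, l2⟩ := neg_log_one_sub_div_bounds hq0 (by linarith)
  have hx := abs_two_mul_inner_re_le hω u v
  rw [quadCoeff]
  set L := -Real.log (1 - t ^ 2) / t ^ 2
  set i := 1 / (1 - t ^ 2) with hi
  set x := 2 * (inner ℂ (ω • u) v).re
  set S := ‖u‖ ^ 2 + ‖v‖ ^ 2
  have hS : 0 ≤ S := by positivity
  have h1 : |n * L| ≤ 2 * n := by
    rw [abs_of_nonneg (mul_nonneg (by positivity) (by linarith))]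
    have : (0 : ℝ) ≤ n := by positivity
    nlinarith
  have h2 : |S / (1 - t ^ 2)| ≤ 2 * S := by
    rw [div_eq_mul_one_div, ← hi, abs_of_nonneg (by positivity)]; nlinarith
  have h3 : |t * x / (1 - t ^ 2)| ≤ 2 * S := by
    rw [div_eq_mul_one_div, ← hi, abs_mul, abs_mul, abs_of_pos ht0, abs_of_pos hinv0]
    have : t * |x| ≤ 1 * S := mul_le_mul (by linarith) hx (abs_nonneg _) (by norm_num)
    nlinarith [mul_nonneg ht0.le (abs_nonneg x)]
  have h4 : |n * L - S / (1 - t ^ 2) + t * x / (1 - t ^ 2)|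
      ≤ |n * L| + |S / (1 - t ^ 2)| + |t * x / (1 - t ^ 2)| :=
    (abs_add_le _ _).trans (add_le_add (abs_sub _ _) le_rfl)
  have : (0 : ℝ) ≤ n * S := by positivity
  nlinarith

lemma tendsto_quadCoeff (ω : ℂ) (u v : Cn n) :
    Tendsto (quadCoeff ω u v) (𝓝[>] 0) (𝓝 (n - (‖u‖ ^ 2 + ‖v‖ ^ 2))) := by
  have h1 := tendsto_neg_log_one_sub_sq_div.const_mul (n : ℝ)
  have h2 : Tendsto (fun t : ℝ => -(‖u‖ ^ 2 + ‖v‖ ^ 2) / (1 - t ^ 2)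
      + t * (2 * (inner ℂ (ω • u) v).re) / (1 - t ^ 2)) (𝓝[>] 0)
      (𝓝 (-(‖u‖ ^ 2 + ‖v‖ ^ 2))) := by
    have : ContinuousAt (fun t : ℝ => -(‖u‖ ^ 2 + ‖v‖ ^ 2) / (1 - t ^ 2)
      + t * (2 * (inner ℂ (ω • u) v).re) / (1 - t ^ 2)) 0 := by
      apply ContinuousAt.add <;> apply ContinuousAt.div <;> first | fun_prop | norm_num
    have h := this.tendsto
    norm_num at h
    simpa using h.mono_left nhdsWithin_le_nhds
  have h3 := h1.add h2
  rw [mul_one, ← sub_eq_add_neg] at h3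
  refine h3.congr fun t => ?_
  rw [quadCoeff]; ring

end Correlation

section Expansion

open Filter Topology Complex

variable {n : ℕ}

/-- The law of three independent standard complex Gaussian vectors. -/
noncomputable abbrev tripleGaussian (n : ℕ) : Measure (Cn n × Cn n × Cn n) :=
  (stdGaussian n).prod ((stdGaussian n).prod (stdGaussian n))

/-- The product `f(X) g(Y)` for the pair with common component `√r z` and independent components
`√(1-r) u` and `√(1-r) v`. -/
noncomputable def splitProd (f g : Cn n → ℝ) (r : ℝ) (p : Cn n × Cn n × Cn n) : ℝ :=
  f (Real.sqrt r • p.1 + Real.sqrt (1 - r) • p.2.1)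
    * g (Real.sqrt r • p.1 + Real.sqrt (1 - r) • p.2.2)

lemma measurable_splitProd {f g : Cn n → ℝ} (hf : Measurable f) (hg : Measurable g) (r : ℝ) :
    Measurable (splitProd f g r) := by
  unfold splitProd; fun_prop

lemma integrable_abs_splitProd_mul_exp {f g : Cn n → ℝ} (hf : Tame f) (hg : Tame g) {r : ℝ}
    (hr0 : 0 ≤ r) (hr1 : r ≤ 1) :
    Integrable (fun p => |splitProd f g r p| * Real.exp (1 / 4 * (‖p.2.1‖ ^ 2 + ‖p.2.2‖ ^ 2)))
      (tripleGaussian n) := by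
  have hfm := hf.measurable
  have hgm := hg.measurable
  have hm := measurable_splitProd hfm hgm r
  have h1 := measurePreserving_fst_snd_fst.integrable_comp_of_integrable
    (hf.integrable_mix hr0 hr1)
  have hmp : MeasurePreserving (fun p : Cn n × Cn n × Cn n => (p.1, p.2.2)) (tripleGaussian n)
      ((stdGaussian n).prod (stdGaussian n)) :=
    (MeasurePreserving.id _).prod measurePreserving_snd
  have h2 := hmp.integrable_comp_of_integrable (hg.integrable_mix hr0 hr1)
  refine (h1.add h2).mono' (by fun_prop) (Eventually.of_forall fun p => ?_)
  simp only [Pi.add_apply, Function.comp_def, splitProd]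
  rw [Real.norm_eq_abs, abs_mul, abs_abs, abs_mul, Real.abs_exp]
  set a := f (Real.sqrt r • p.1 + Real.sqrt (1 - r) • p.2.1)
  set b := g (Real.sqrt r • p.1 + Real.sqrt (1 - r) • p.2.2)
  have e : ∀ x : ℝ, Real.exp (1 / 2 * x) = Real.exp (1 / 4 * x) ^ 2 := fun x => by
    rw [← Real.exp_nat_mul]; congr 1; push_cast; ring
  rw [e, e, mul_add, Real.exp_add]
  set A := Real.exp (1 / 4 * ‖p.2.1‖ ^ 2)
  set B := Real.exp (1 / 4 * ‖p.2.2‖ ^ 2)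
  rw [← sq_abs a, ← sq_abs b]
  nlinarith [sq_nonneg (|a| * A - |b| * B), sq_nonneg (|a| * A), sq_nonneg (|b| * B)]

lemma integrable_splitProd_mul {f g : Cn n → ℝ} (hf : Tame f) (hg : Tame g) {r : ℝ}
    (hr0 : 0 ≤ r) (hr1 : r ≤ 1) {h : Cn n × Cn n × Cn n → ℝ} {B : ℝ} (hh : Measurable h)
    (hB : ∀ p, |h p| ≤ B * Real.exp (1 / 4 * (‖p.2.1‖ ^ 2 + ‖p.2.2‖ ^ 2))) :
    Integrable (fun p => splitProd f g r p * h p) (tripleGaussian n) := by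
  have hm := measurable_splitProd hf.measurable hg.measurable r
  refine ((integrable_abs_splitProd_mul_exp hf hg hr0 hr1).const_mul B).mono' (by fun_prop)
    (Eventually.of_forall fun p => ?_)
  rw [Real.norm_eq_abs, abs_mul]
  nlinarith [hB p, abs_nonneg (splitProd f g r p)]

lemma integrable_corr {f g : Cn n → ℝ} (hfm : Measurable f) (hgm : Measurable g)
    (hf2 : Integrable (fun w => f w ^ 2) (stdGaussian n))
    (hg2 : Integrable (fun w => g w ^ 2) (stdGaussian n)) {ρ : ℂ} (hρ : normSq ρ ≤ 1) :
    Integrable (fun p : Cn n × Cn n => f p.1 * g (ρ • p.1 + Real.sqrt (1 - normSq ρ) • p.2))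
      ((stdGaussian n).prod (stdGaussian n)) := by
  have h1 := hf2.comp_fst (stdGaussian n)
  have h2 := (measurePreserving_corr hρ).integrable_comp_of_integrable hg2
  refine (h1.add h2).mono' (by fun_prop) (Eventually.of_forall fun p => ?_)
  simp only [Pi.add_apply, Function.comp_def]
  set a := f p.1
  set b := g (ρ • p.1 + Real.sqrt (1 - normSq ρ) • p.2)
  rw [Real.norm_eq_abs, abs_le]
  constructor <;> nlinarith [sq_nonneg (a + b), sq_nonneg (a - b)]

/-- The correlation `r + (1 - r) t ω` is produced from independent vectors by the density of a
pair with correlation `t ω`. -/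
lemma corr_eq_integral_splitProd {f g : Cn n → ℝ} (hf : Tame f) (hg : Tame g) {r t : ℝ}
    (hr0 : 0 ≤ r) (hr1 : r ≤ 1) (ht0 : 0 < t) (ht1 : t < 1) {ω : ℂ} (hω : normSq ω = 1)
    (hint : Integrable (fun p => splitProd f g r p * Real.exp (t * (2 * (inner ℂ (ω • p.2.1)
      p.2.2).re) + t ^ 2 * quadCoeff ω p.2.1 p.2.2 t)) (tripleGaussian n)) :
    corr f g (r + (1 - r) * t * ω) = ∫ p, splitProd f g r p * Real.exp (t * (2 *
      (inner ℂ (ω • p.2.1) p.2.2).re) + t ^ 2 * quadCoeff ω p.2.1 p.2.2 t)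
      ∂tripleGaussian n := by
  have hfm := hf.measurable
  have hgm := hg.measurable
  have hh : Measurable fun q : Cn n × Cn n => f q.1 * g q.2 := by fun_prop
  obtain ⟨hρ, hmp, h⟩ := integral_corr_split (n := n) hr0 hr1 ht0.le ht1.le hω hh
  have hs : 0 < Real.sqrt (1 - t ^ 2) := Real.sqrt_pos.2 (by nlinarith)
  have hint2 : Integrable (fun p : Cn n × Cn n × Cn n =>
      f (Real.sqrt r • p.1 + Real.sqrt (1 - r) • p.2.1) *
        g (Real.sqrt r • p.1 + Real.sqrt (1 - r) •
          (((t : ℂ) * ω) • p.2.1 + Real.sqrt (1 - t ^ 2) • p.2.2))) (tripleGaussian n) := by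
    refine hmp.integrable_comp_of_integrable (g := fun q => f q.1 * g q.2) ?_
    rw [integrable_map_measure hh.aestronglyMeasurable (by fun_prop)]
    exact integrable_corr hfm hgm hf.sq_integrable hg.sq_integrable hρ
  rw [corr]
  refine h.trans ?_
  rw [integral_prod _ hint2, integral_prod _ hint]
  refine integral_congr_ae ?_
  filter_upwards [hint2.prod_right_ae, hint.prod_right_ae] with z hz1 hz2
  rw [integral_prod _ hz1, integral_prod _ hz2]
  refine integral_congr_ae (Eventually.of_forall fun u => ?_)
  simp only
  have hH : Measurable fun y : Cn n => f (Real.sqrt r • z + Real.sqrt (1 - r) • u)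
      * g (Real.sqrt r • z + Real.sqrt (1 - r) • y) := by fun_prop
  rw [integral_comp_affine (((t : ℂ) * ω) • u) hs hH]
  refine integral_congr_ae (Eventually.of_forall fun v => ?_)
  simp only
  rw [affineDensity_eq_exp hω u v ht0 ht1, mul_comm]
  rfl

/-- Second order expansion of the correlation function at `r` in the direction `ω`. -/
lemma tendsto_corr_quotient {f g : Cn n → ℝ} (hf : Tame f) (hg : Tame g) {r : ℝ}
    (hr0 : 0 ≤ r) (hr1 : r ≤ 1) {ω : ℂ} (hω : normSq ω = 1) :
    Integrable (fun p => splitProd f g r p * ((2 * (inner ℂ (ω • p.2.1) p.2.2).re) ^ 2 / 2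
      + (n - (‖p.2.1‖ ^ 2 + ‖p.2.2‖ ^ 2)))) (tripleGaussian n) ∧
    Tendsto (fun t : ℝ => (corr f g (r + (1 - r) * t * ω) - ∫ p, splitProd f g r p ∂tripleGaussian n
      - t * ∫ p, splitProd f g r p * (2 * (inner ℂ (ω • p.2.1) p.2.2).re) ∂tripleGaussian n) / t ^ 2)
      (𝓝[>] 0) (𝓝 (∫ p, splitProd f g r p * ((2 * (inner ℂ (ω • p.2.1) p.2.2).re) ^ 2 / 2
      + (n - (‖p.2.1‖ ^ 2 + ‖p.2.2‖ ^ 2))) ∂tripleGaussian n)) := by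
  have hm := measurable_splitProd hf.measurable hg.measurable r
  set S : Cn n × Cn n × Cn n → ℝ := fun p => ‖p.2.1‖ ^ 2 + ‖p.2.2‖ ^ 2 with hS
  set X : Cn n × Cn n × Cn n → ℝ := fun p => 2 * (inner ℂ (ω • p.2.1) p.2.2).re with hX
  have hXm : Measurable X := by
    have : Continuous X := continuous_const.mul (Complex.continuous_re.comp
      ((continuous_snd.fst.const_smul ω).inner continuous_snd.snd))
    exact this.measurable
  have hSm : Measurable S := by fun_prop
  set Y : ℝ → Cn n × Cn n × Cn n → ℝ := fun t p => quadCoeff ω p.2.1 p.2.2 t with hY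
  have hYm : ∀ t, Measurable (Y t) := by
    intro t
    have : Y t = fun p => n * (-Real.log (1 - t ^ 2) / t ^ 2) - S p / (1 - t ^ 2)
        + t * X p / (1 - t ^ 2) := rfl
    rw [this]; fun_prop
  have hS0 : ∀ p, 0 ≤ S p := fun p => by positivity
  have hXle : ∀ p, |X p| ≤ S p := fun p => abs_two_mul_inner_re_le hω p.2.1 p.2.2
  set K : ℝ := 2 * n + 4 with hK
  have hK1 : 1 ≤ K := by rw [hK]; have : (0 : ℝ) ≤ n := by positivity
                         linarith
  have hXK : ∀ p, |X p| ≤ K * (1 + S p) := fun p => by nlinarith [hXle p, hS0 p]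
  obtain ⟨C, τ, hC, hτ, hbound⟩ := exists_abs_exp_remainder_le (K := K) (κ := 1 / 4)
    (by positivity) (by norm_num)
  -- `t ≤ 1 / 2` keeps `1 - t²` away from zero
  have hτ' : 0 < min τ (1 / 2) := by positivity
  have hD := integrable_abs_splitProd_mul_exp hf hg hr0 hr1
  set R : ℝ → Cn n × Cn n × Cn n → ℝ := fun t p =>
    (Real.exp (t * X p + t ^ 2 * Y t p) - 1 - t * X p) / t ^ 2 with hR
  have hRm : ∀ t, Measurable (R t) := fun t => by
    have := hYm t
    fun_prop
  have hRle : ∀ t ∈ Set.Ioc 0 (min τ (1 / 2)), ∀ p, |R t p| ≤ C * Real.exp (1 / 4 * S p) :=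
    fun t ht p => hbound t _ _ _ ht.1 (ht.2.trans (min_le_left _ _)) (hS0 p) (hXK p)
      (abs_quadCoeff_le hω _ _ ht.1 (ht.2.trans (min_le_right _ _)))
  have hi0 : Integrable (splitProd f g r) (tripleGaussian n) := by
    have := integrable_splitProd_mul hf hg hr0 hr1 (h := fun _ => 1) (B := 1) measurable_const
      fun p => by
        rw [abs_one, one_mul]; exact Real.one_le_exp (by positivity)
    simpa using this
  have hiX : Integrable (fun p => splitProd f g r p * X p) (tripleGaussian n) := by
    refine integrable_splitProd_mul hf hg hr0 hr1 (B := 1 + 1 / (1 / 4)) hXm fun p => ?_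
    exact ((hXle p).trans (by linarith)).trans (one_add_le_mul_exp (by norm_num) (hS0 p))
  have hiR : ∀ t ∈ Set.Ioc 0 (min τ (1 / 2)),
      Integrable (fun p => splitProd f g r p * R t p) (tripleGaussian n) := fun t ht =>
    integrable_splitProd_mul hf hg hr0 hr1 (hRm t) (hRle t ht)
  have hmem : Set.Ioc 0 (min τ (1 / 2)) ∈ 𝓝[>] (0 : ℝ) := Ioc_mem_nhdsGT hτ'
  constructor
  · refine integrable_splitProd_mul hf hg hr0 hr1 (B := (n + 1) * (1 + 1 / (1 / 8)) ^ 2)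
      (by fun_prop) fun p => ?_
    have h1 := one_add_le_mul_exp (δ := 1 / 8) (by norm_num) (hS0 p)
    have h2 : Real.exp (1 / 4 * S p) = Real.exp (1 / 8 * S p) ^ 2 := by
      rw [← Real.exp_nat_mul]; congr 1; push_cast; ring
    have h3 : (1 + S p) ^ 2 ≤ (1 + 1 / (1 / 8)) ^ 2 * Real.exp (1 / 4 * S p) := by
      rw [h2, ← mul_pow]
      exact pow_le_pow_left₀ (by linarith [hS0 p]) h1 2
    have h4 : X p ^ 2 ≤ S p ^ 2 := by
      rw [← sq_abs]; exact pow_le_pow_left₀ (abs_nonneg _) (hXle p) 2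
    have hn : (0 : ℝ) ≤ n := by positivity
    have h5 : |X p ^ 2 / 2 + (n - S p)| ≤ (n + 1) * (1 + S p) ^ 2 := by
      have := hS0 p
      rw [abs_le]
      constructor <;> nlinarith [sq_nonneg (X p), mul_nonneg hn (hS0 p),
        mul_nonneg hn (sq_nonneg (S p)), sq_nonneg (S p)]
    refine h5.trans ?_
    rw [mul_assoc]
    exact mul_le_mul_of_nonneg_left h3 (by positivity)
  · have hlim : Tendsto (fun t => ∫ p, splitProd f g r p * R t p ∂tripleGaussian n) (𝓝[>] 0)
        (𝓝 (∫ p, splitProd f g r p * (X p ^ 2 / 2 + (n - S p)) ∂tripleGaussian n)) := by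
      refine tendsto_integral_filter_of_dominated_convergence
        (fun p => C * (|splitProd f g r p| * Real.exp (1 / 4 * S p)))
        (Eventually.of_forall fun t => by have := hRm t; fun_prop) ?_ (hD.const_mul C) ?_
      · filter_upwards [hmem] with t ht
        refine Eventually.of_forall fun p => ?_
        rw [Real.norm_eq_abs, abs_mul]
        nlinarith [hRle t ht p, abs_nonneg (splitProd f g r p)]
      · refine Eventually.of_forall fun p => ?_
        exact (tendsto_exp_remainder (X p) (tendsto_quadCoeff ω p.2.1 p.2.2)).const_mul _
    refine hlim.congr' ?_
    filter_upwards [hmem] with t ht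
    have ht0 : 0 < t := ht.1
    have e1 : (fun p => splitProd f g r p * Real.exp (t * X p + t ^ 2 * Y t p))
        = fun p => splitProd f g r p + (t * (splitProd f g r p * X p)
          + t ^ 2 * (splitProd f g r p * R t p)) := by
      funext p
      simp only [hR]
      field_simp
      ring
    have hi : Integrable (fun p => t * (splitProd f g r p * X p)
          + t ^ 2 * (splitProd f g r p * R t p)) (tripleGaussian n) :=
      (hiX.const_mul t).add ((hiR t ht).const_mul _)
    have hiE : Integrable (fun p => splitProd f g r p * Real.exp (t * X p + t ^ 2 * Y t p))
        (tripleGaussian n) := by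
      rw [e1]; exact hi0.add hi
    rw [corr_eq_integral_splitProd hf hg hr0 hr1 ht0
      ((ht.2.trans (min_le_right _ _)).trans_lt (by norm_num)) hω hiE, eq_div_iff (by positivity)]
    simp only [hX, hY] at e1 ⊢
    rw [e1, integral_add hi0 hi, integral_add (hiX.const_mul t) ((hiR t ht).const_mul _),
      integral_const_mul, integral_const_mul]
    ring

/-- Sub-mean value property of all the functions `v ↦ φ (a + s v)`. -/
def AffineSubmean (φ : Cn n → ℝ) : Prop :=
  ∀ (a : Cn n) (s : ℝ), 0 < s → GaussianSubmean fun v => φ (a + s • v)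

/-- Summing over the four directions `i^k` replaces the square of a real part by a squared
modulus. -/
lemma sum_second_order (u v : Cn n) :
    ((2 * (inner ℂ ((1 : ℂ) • u) v).re) ^ 2 / 2 + (n - (‖u‖ ^ 2 + ‖v‖ ^ 2)))
    + ((2 * (inner ℂ ((-1 : ℂ) • u) v).re) ^ 2 / 2 + (n - (‖u‖ ^ 2 + ‖v‖ ^ 2)))
    + ((2 * (inner ℂ (I • u) v).re) ^ 2 / 2 + (n - (‖u‖ ^ 2 + ‖v‖ ^ 2)))
    + ((2 * (inner ℂ ((-I) • u) v).re) ^ 2 / 2 + (n - (‖u‖ ^ 2 + ‖v‖ ^ 2)))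
    = 4 * correlationKernel u v := by
  rw [correlationKernel, ← normSq_eq_norm_sq, normSq_apply]
  simp only [inner_smul_left]
  simp
  ring

/-- The correlation function is subharmonic at `r`, in an infinitesimal form: the mean over the
four points `r + (1 - r) t i^k` exceeds the value at the centre up to `o(t²)`. -/
lemma exists_tendsto_four_point_mean {f g : Cn n → ℝ} (hf : Tame f) (hg : Tame g)
    (hfs : AffineSubmean f) (hgs : AffineSubmean g) {r : ℝ} (hr0 : 0 ≤ r) (hr1 : r < 1) :
    ∃ L : ℝ, 0 ≤ L ∧ Tendsto (fun t : ℝ => (corr f g (r + (1 - r) * t * 1)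
      + corr f g (r + (1 - r) * t * (-1)) + corr f g (r + (1 - r) * t * I)
      + corr f g (r + (1 - r) * t * (-I)) - 4 * corr f g r) / t ^ 2) (𝓝[>] 0) (𝓝 L) := by
  have hfm := hf.measurable
  have hgm := hg.measurable
  set F : ℂ → Cn n × Cn n × Cn n → ℝ := fun ω p => splitProd f g r p *
    ((2 * (inner ℂ (ω • p.2.1) p.2.2).re) ^ 2 / 2 + (n - (‖p.2.1‖ ^ 2 + ‖p.2.2‖ ^ 2))) with hF
  have hi : ∀ ω : ℂ, normSq ω = 1 → Integrable (F ω) (tripleGaussian n) :=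
    fun ω hω => (tendsto_corr_quotient hf hg hr0 hr1.le hω).1
  have ht : ∀ ω : ℂ, normSq ω = 1 → _ := fun ω hω =>
    (tendsto_corr_quotient hf hg hr0 hr1.le hω).2
  have hneg : ∀ ω : ℂ, ∫ p, splitProd f g r p * (2 * (inner ℂ ((-ω) • p.2.1) p.2.2).re)
      ∂tripleGaussian n
      = -∫ p, splitProd f g r p * (2 * (inner ℂ (ω • p.2.1) p.2.2).re) ∂tripleGaussian n := by
    intro ω
    rw [← integral_neg]
    refine integral_congr_ae (Eventually.of_forall fun p => ?_)
    simp only [neg_smul, inner_neg_left, neg_re]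
    ring
  have hM : ∫ p, splitProd f g r p ∂tripleGaussian n = corr f g r := by
    obtain ⟨-, -, h⟩ := integral_corr_split (n := n) hr0 hr1.le le_rfl zero_le_one (ω := 1)
      (by simp) (h := fun q : Cn n × Cn n => f q.1 * g q.2) (by fun_prop)
    simp only [ofReal_zero, mul_zero, zero_mul, add_zero, zero_smul, zero_add, sub_zero,
      ne_eq, OfNat.ofNat_ne_zero, not_false_eq_true, zero_pow, Real.sqrt_one, one_smul] at h
    rw [corr]
    exact h.symm
  have n1 : normSq (1 : ℂ) = 1 := by simp
  have n2 : normSq (-1 : ℂ) = 1 := by simp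
  have n3 : normSq I = 1 := by simp
  have n4 : normSq (-I) = 1 := by simp
  refine ⟨_, ?_, ((((ht 1 n1).add (ht (-1) n2)).add (ht I n3)).add (ht (-I) n4)).congr fun t => ?_⟩
  · have j12 : Integrable (fun p => F 1 p + F (-1) p) (tripleGaussian n) :=
      (hi 1 n1).add (hi (-1) n2)
    have j123 : Integrable (fun p => F 1 p + F (-1) p + F I p) (tripleGaussian n) :=
      j12.add (hi I n3)
    have j1234 : Integrable (fun p => F 1 p + F (-1) p + F I p + F (-I) p) (tripleGaussian n) :=
      j123.add (hi (-I) n4)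
    have e : (fun p => F 1 p + F (-1) p + F I p + F (-I) p) = fun p : Cn n × Cn n × Cn n =>
        splitProd f g r p * correlationKernel p.2.1 p.2.2 * 4 := by
      funext p
      rw [mul_assoc, mul_comm (correlationKernel _ _), ← sum_second_order, mul_add, mul_add,
        mul_add]
    have key : ∫ p, F 1 p ∂tripleGaussian n + ∫ p, F (-1) p ∂tripleGaussian n
        + ∫ p, F I p ∂tripleGaussian n + ∫ p, F (-I) p ∂tripleGaussian n
        = ∫ p : Cn n × Cn n × Cn n, splitProd f g r p * correlationKernel p.2.1 p.2.2 * 4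
          ∂tripleGaussian n := by
      rw [← e, integral_add j123 (hi (-I) n4), integral_add j12 (hi I n3),
        integral_add (hi 1 n1) (hi (-1) n2)]
    refine le_of_le_of_eq ?_ key.symm
    rw [e] at j1234
    -- freezing the common component `z` leaves the pairing of two plurisubharmonic functions
    rw [integral_prod _ j1234]
    refine integral_nonneg fun z => ?_
    simp only
    rw [integral_mul_const]
    refine mul_nonneg ?_ (by norm_num)
    have hs : 0 < Real.sqrt (1 - r) := Real.sqrt_pos.2 (by linarith)
    exact integral_mul_mul_correlationKernel_nonneg (hf.comp_affine (Real.sqrt r • z) hs)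
      (hg.comp_affine (Real.sqrt r • z) hs)
      (hfs _ _ hs) (hgs _ _ hs)
  · -- the first order terms in opposite directions cancel
    rw [hneg 1, hneg I, hM]
    ring

end Expansion

/-! ### Monotonicity of the correlation function -/

section Monotone

open Filter Topology Complex

variable {n : ℕ}

lemma continuous_corr_boundedContinuous {f : Cn n → ℝ} (hf : Tame f)
    (φ : BoundedContinuousFunction (Cn n) ℝ) : Continuous fun r : ℝ => corr f φ r := by
  have hfm := hf.measurable
  have hφ : Measurable φ := φ.continuous.measurable
  refine continuous_of_dominated (bound := fun p : Cn n × Cn n => |f p.1| * ‖φ‖)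
    (fun r => Measurable.aestronglyMeasurable (by fun_prop))
    (fun r => Eventually.of_forall fun p => ?_)
    ((hf.integrable.abs.comp_fst (stdGaussian n)).mul_const _)
    (Eventually.of_forall fun p => ?_)
  · rw [norm_mul, Real.norm_eq_abs]
    exact mul_le_mul_of_nonneg_left (φ.norm_coe_le_norm _) (abs_nonneg _)
  · have h := φ.continuous
    simp only [normSq_ofReal, Complex.coe_smul]
    fun_prop

/-- A Cauchy-Schwarz bound in its additive form. -/
lemma abs_corr_le {f h : Cn n → ℝ} (hf : Tame f) (hh : Measurable h)
    (hh2 : Integrable (fun w => h w ^ 2) (stdGaussian n)) {ρ : ℂ} (hρ : normSq ρ ≤ 1) {δ : ℝ}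
    (hδ : 0 < δ) : 
    |corr f h ρ| ≤ δ * (∫ w, f w ^ 2 ∂stdGaussian n) + δ⁻¹ * ∫ w, h w ^ 2 ∂stdGaussian n := by
  have hfm := hf.measurable
  have h1 := hf.sq_integrable.comp_fst (stdGaussian n)
  have hmp := measurePreserving_corr (n := n) hρ
  have h2 := hmp.integrable_comp_of_integrable hh2
  have hle : ∀ p : Cn n × Cn n, ‖f p.1 * h (ρ • p.1 + Real.sqrt (1 - normSq ρ) • p.2)‖
      ≤ δ * f p.1 ^ 2 + δ⁻¹ * h (ρ • p.1 + Real.sqrt (1 - normSq ρ) • p.2) ^ 2 := by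
    intro p
    set a := f p.1
    set b := h (ρ • p.1 + Real.sqrt (1 - normSq ρ) • p.2)
    rw [norm_mul, Real.norm_eq_abs, Real.norm_eq_abs, ← sq_abs a, ← sq_abs b]
    have e : δ * |a| ^ 2 + δ⁻¹ * |b| ^ 2 - |a| * |b|
        = δ⁻¹ * ((δ * |a| - |b|) ^ 2 + δ * (|a| * |b|)) := by field_simp; ring
    have : 0 ≤ δ⁻¹ * ((δ * |a| - |b|) ^ 2 + δ * (|a| * |b|)) := by positivity
    linarith
  have hi := (h1.const_mul δ).add (h2.const_mul δ⁻¹)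
  refine (norm_integral_le_of_norm_le hi (Eventually.of_forall hle)).trans (le_of_eq ?_)
  refine (integral_add (h1.const_mul δ) (h2.const_mul δ⁻¹)).trans ?_
  rw [integral_const_mul, integral_const_mul]
  congr 2
  · rw [integral_fun_fst (fun w => f w ^ 2)]; simp
  · conv_rhs => rw [← hmp.map_eq]
    rw [integral_map hmp.measurable.aemeasurable (Measurable.aestronglyMeasurable (by fun_prop))]
    rfl

/-- Continuity up to the end point `r = 1`, where the pair degenerates: `g` is approximated in
`L²(γ)` by bounded continuous functions, uniformly in `r` since both marginals are `γ`. -/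
lemma continuousOn_corr {f g : Cn n → ℝ} (hf : Tame f) (hg : Tame g) :
    ContinuousOn (fun r : ℝ => corr f g r) (Set.Icc 0 1) := by
  have hgm := hg.measurable
  refine continuousOn_of_uniform_approx_of_continuousOn fun U hU => ?_
  obtain ⟨ε, hε, hεU⟩ := Metric.mem_uniformity_dist.1 hU
  set A := ∫ w, f w ^ 2 ∂stdGaussian n with hA
  have hA0 : 0 ≤ A := integral_nonneg fun w => sq_nonneg _
  set δ := ε / (2 * (A + 1)) with hδ
  have hδ0 : 0 < δ := by positivity
  have hgL : MemLp g (ENNReal.ofReal 2) (stdGaussian n) := by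
    rw [ENNReal.ofReal_ofNat]
    exact (memLp_two_iff_integrable_sq hgm.aestronglyMeasurable).2 hg.sq_integrable
  obtain ⟨φ, hφ, hφL⟩ := hgL.exists_boundedContinuous_integral_rpow_sub_le (by norm_num)
    (ε := δ ^ 2) (by positivity)
  rw [ENNReal.ofReal_ofNat] at hφL hgL
  simp only [Real.rpow_two, Real.norm_eq_abs, sq_abs] at hφ
  have hφm : Measurable φ := φ.continuous.measurable
  have hd2 : Integrable (fun w => (g w - φ w) ^ 2) (stdGaussian n) := (hgL.sub hφL).integrable_sq
  have hφ2 : Integrable (fun w => φ w ^ 2) (stdGaussian n) := hφL.integrable_sq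
  refine ⟨fun r => corr f φ r, (continuous_corr_boundedContinuous hf φ).continuousOn,
    fun r hr => hεU ?_⟩
  have hρ : normSq (r : ℂ) ≤ 1 := by rw [normSq_ofReal]; nlinarith [hr.1, hr.2]
  have hsub : corr f g r - corr f φ r = corr f (fun w => g w - φ w) r := by
    simp only [corr, mul_sub]
    rw [integral_sub (integrable_corr hf.measurable hgm hf.sq_integrable hg.sq_integrable hρ)
      (integrable_corr hf.measurable hφm hf.sq_integrable hφ2 hρ)]
  rw [Real.dist_eq, hsub]
  refine (abs_corr_le hf (by fun_prop) hd2 hρ hδ0).trans_lt ?_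
  have h1 : δ⁻¹ * ∫ w, (g w - φ w) ^ 2 ∂stdGaussian n ≤ δ := by
    rw [inv_mul_le_iff₀ hδ0, ← sq]; exact hφ
  have h2 : δ * (A + 1) = ε / 2 := by rw [hδ]; field_simp
  nlinarith

/-- The maximum principle for `ρ ↦ corr f g ρ`, which is a radial function on the unit disc. -/
theorem corr_zero_le_corr_one {f g : Cn n → ℝ} (hf : Tame f) (hg : Tame g)
    (hfs : AffineSubmean f) (hgs : AffineSubmean g)
    (hsymm : ∀ (ω : ℂ) (w : Cn n), ‖ω‖ = 1 → f (ω • w) = f w) :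
    corr f g 0 ≤ corr f g 1 := by
  -- the perturbation `ε |ρ|²` makes the function strictly subharmonic
  refine le_of_forall_pos_le_add fun ε hε => ?_
  obtain ⟨r, hr, hmax⟩ := isCompact_Icc.exists_isMaxOn (Set.nonempty_Icc.2 zero_le_one)
    ((continuousOn_corr hf hg).add (f := fun r : ℝ => corr f g r) (g := fun r : ℝ => ε * r ^ 2)
      (by fun_prop))
  have hmax' : ∀ s ∈ Set.Icc (0 : ℝ) 1, corr f g s + ε * s ^ 2 ≤ corr f g r + ε * r ^ 2 :=
    fun s hs => hmax hs
  rcases hr.2.eq_or_lt with h1 | h1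
  · have := hmax' 0 ⟨le_rfl, zero_le_one⟩
    rw [h1] at this
    simpa using this
  · exfalso
    obtain ⟨L, hL, hlim⟩ := exists_tendsto_four_point_mean hf hg hfs hgs hr.1 h1
    have hmem : Set.Ioc (0 : ℝ) 1 ∈ 𝓝[>] (0 : ℝ) := Ioc_mem_nhdsGT one_pos
    have hbound : L ≤ -(4 * ε * (1 - r) ^ 2) := by
      refine le_of_tendsto hlim ?_
      filter_upwards [hmem] with t ht
      have hpt : ∀ ω : ℂ, normSq ω = 1 → corr f g (r + (1 - r) * t * ω)
          ≤ corr f g r + ε * r ^ 2 - ε * normSq (r + (1 - r) * t * ω) := by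
        intro ω hω
        have hρ := (integral_corr_split (n := n) hr.1 hr.2 ht.1.le ht.2 hω
          (h := fun _ => 0) measurable_const).1
        rw [corr_eq_corr_norm hf.measurable hg.measurable hsymm, normSq_eq_norm_sq]
        rw [normSq_eq_norm_sq] at hρ
        have := hmax' ‖(r + (1 - r) * t * ω : ℂ)‖ ⟨norm_nonneg _, by
          nlinarith [norm_nonneg (r + (1 - r) * t * ω : ℂ)]⟩
        linarith
      have a1 := hpt 1 (by simp)
      have a2 := hpt (-1) (by simp)
      have a3 := hpt I (by simp)
      have a4 := hpt (-I) (by simp)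
      have hsum : normSq (r + (1 - r) * t * 1) + normSq (r + (1 - r) * t * (-1))
          + normSq (r + (1 - r) * t * I) + normSq (r + (1 - r) * t * (-I))
          = 4 * r ^ 2 + 4 * (1 - r) ^ 2 * t ^ 2 := by
        simp only [normSq_apply]
        simp
        ring
      rw [div_le_iff₀ (pow_pos ht.1 2)]
      have : ε * (normSq (r + (1 - r) * t * 1) + normSq (r + (1 - r) * t * (-1))
          + normSq (r + (1 - r) * t * I) + normSq (r + (1 - r) * t * (-I)))
          = ε * (4 * r ^ 2 + 4 * (1 - r) ^ 2 * t ^ 2) := by rw [hsum]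
      linarith
    have : 0 < 4 * ε * (1 - r) ^ 2 := by
      have : 0 < 1 - r := by linarith
      positivity
    linarith

end Monotone

/-! ### Plurisubharmonic functions of the growth class -/

section Psh

open Filter Topology

variable {n : ℕ}

lemma ofReal_abs_toReal_le (x : EReal) : ENNReal.ofReal |x.toReal| ≤ x.abs := by
  induction x with
  | bot => simp
  | top => simp
  | coe x => rw [EReal.toReal_coe, EReal.abs_def]

lemma Plurisubharmonic.measurable_toReal {f : Cn n → EReal} (hf : Plurisubharmonic f) :
    Measurable fun w => (f w).toReal := hf.usc.measurable.ereal_toReal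

lemma stdGaussian_absolutelyContinuous : stdGaussian n ≪ volume :=
  withDensity_absolutelyContinuous _ _

lemma GrowthClass.ae_ne_bot {f : Cn n → EReal} (hf : Plurisubharmonic f) (hG : GrowthClass f) :
    ∀ᵐ w : Cn n, f w ≠ ⊥ := by
  have habs : Measurable fun w => (f w).abs := by
    have e : (fun w => (f w).abs) = fun w => (f w).toENNReal + (-f w).toENNReal := by
      funext w
      induction f w with
      | bot => simp
      | top => simp
      | coe x =>
        rw [EReal.abs_def, ← EReal.coe_neg, EReal.real_coe_toENNReal, EReal.real_coe_toENNReal]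
        rcases le_total 0 x with h | h
        · rw [abs_of_nonneg h, ENNReal.ofReal_of_nonpos (neg_nonpos.2 h), add_zero]
        · rw [abs_of_nonpos h, ENNReal.ofReal_of_nonpos h, zero_add]
    rw [e]
    exact hf.usc.measurable.ereal_toENNReal.add hf.usc.measurable.neg.ereal_toENNReal
  have h : ∀ m : ℕ, ∀ᵐ w : Cn n, w ∈ Metric.closedBall (0 : Cn n) m → f w ≠ ⊥ := by
    intro m
    have h1 := ae_lt_top (habs.pow_const 2)
      (hG.locally_sq_integrable _ (isCompact_closedBall (0 : Cn n) m)).ne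
    rw [ae_restrict_iff' Metric.isClosed_closedBall.measurableSet] at h1
    filter_upwards [h1] with w hw hwm hbot
    have := hw hwm
    rw [hbot] at this
    simp at this
  filter_upwards [ae_all_iff.2 h] with w hw
  obtain ⟨m, hm⟩ := exists_nat_ge ‖w‖
  exact hw m (by simpa using hm)

/-- The exponent `2 - ε` lies below the Gaussian exponent `2`. -/
lemma exists_growth_radius {ε c δ : ℝ} (hε : 0 < ε) (hδ : 0 < δ) :
    ∃ R : ℝ, 0 < R ∧ ∀ x, R ≤ x → 2 * (c * x ^ (2 - ε)) ≤ δ * x ^ 2 := by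
  have h := ((tendsto_rpow_neg_atTop hε).const_mul (2 * c)).eventually
    (gt_mem_nhds (show 2 * c * 0 < δ by simpa using hδ))
  obtain ⟨R, hR⟩ := eventually_atTop.1 h
  refine ⟨max R 1, by positivity, fun x hx => ?_⟩
  have hx0 : 0 < x := lt_of_lt_of_le (by positivity) hx
  rw [sub_eq_add_neg, Real.rpow_add hx0, Real.rpow_two]
  have := hR x ((le_max_left _ _).trans hx)
  nlinarith [sq_nonneg x]

lemma GrowthClass.tame {f : Cn n → EReal} (hf : Plurisubharmonic f) (hG : GrowthClass f) :
    Tame fun w => (f w).toReal := by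
  have hm := hf.measurable_toReal
  refine ⟨hm, fun κ hκ => ?_⟩
  obtain ⟨ε, c, C, hε, hc, hC, hgrow⟩ := hG.growth
  set δ := (1 - κ) / 2 with hδ
  have hδ0 : 0 < δ := by rw [hδ]; linarith
  obtain ⟨R, hR0, hR⟩ := exists_growth_radius (c := c) hε hδ0
  set ρ := max R C with hρ
  set K := Metric.closedBall (0 : Cn n) ρ with hK
  have hKm : MeasurableSet K := Metric.isClosed_closedBall.measurableSet
  have hmeas : Measurable fun w : Cn n => (f w).toReal ^ 2 * Real.exp (κ * ‖w‖ ^ 2) := by fun_prop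
  rw [← integrableOn_univ, ← Set.union_compl_self K]
  refine IntegrableOn.union ?_ ?_
  · -- on the ball only local square integrability matters
    have h1 : IntegrableOn (fun w : Cn n => (f w).toReal ^ 2) K volume := by
      refine ⟨(hm.pow_const 2).aestronglyMeasurable, ?_⟩
      refine lt_of_le_of_lt (lintegral_mono fun w => ?_)
        (hG.locally_sq_integrable K (isCompact_closedBall _ _))
      rw [← ofReal_norm, Real.norm_eq_abs, abs_pow, ENNReal.ofReal_pow (abs_nonneg _)]
      exact pow_le_pow_left₀ zero_le (ofReal_abs_toReal_le _) 2
    have hle : stdGaussian n ≤ ENNReal.ofReal ((Real.pi ^ n)⁻¹) • volume := by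
      rw [← withDensity_const]
      refine withDensity_mono (Eventually.of_forall fun w => ENNReal.ofReal_le_ofReal ?_)
      have : Real.exp (-‖w‖ ^ 2) ≤ 1 := Real.exp_le_one_iff.2 (by nlinarith [sq_nonneg ‖w‖])
      have h0 : 0 ≤ (Real.pi ^ n)⁻¹ := by positivity
      nlinarith
    have h2 : IntegrableOn (fun w : Cn n => (f w).toReal ^ 2) K (stdGaussian n) := by
      refine IntegrableOn.mono_measure ?_ hle
      rw [IntegrableOn, Measure.restrict_smul]
      exact Integrable.smul_measure h1 ENNReal.ofReal_ne_top
    refine (h2.mul_const (Real.exp (|κ| * ρ ^ 2))).mono' hmeas.aestronglyMeasurable ?_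
    rw [ae_restrict_iff' hKm]
    refine Eventually.of_forall fun w hw => ?_
    have hw' : ‖w‖ ≤ ρ := by simpa [hK] using hw
    rw [Real.norm_eq_abs, abs_of_nonneg (by positivity)]
    refine mul_le_mul_of_nonneg_left (Real.exp_le_exp.2 ?_) (sq_nonneg _)
    have h3 : ‖w‖ ^ 2 ≤ ρ ^ 2 := pow_le_pow_left₀ (norm_nonneg _) hw' 2
    nlinarith [le_abs_self κ, abs_nonneg κ, sq_nonneg ‖w‖]
  · refine (integrable_exp_mul_norm_sq (n := n) (κ := (1 + κ) / 2)
      (by linarith)).integrableOn.mono' hmeas.aestronglyMeasurable ?_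
    rw [ae_restrict_iff' hKm.compl]
    filter_upwards [stdGaussian_absolutelyContinuous.ae_le hgrow] with w hw hwK
    have hwρ : ρ < ‖w‖ := by simpa [hK] using hwK
    have h1 := (ofReal_abs_toReal_le (f w)).trans
      (hw ((le_max_right _ _).trans hwρ.le))
    rw [ENNReal.ofReal_le_ofReal_iff (by positivity)] at h1
    have h2 := hR ‖w‖ ((le_max_left _ _).trans hwρ.le)
    rw [Real.norm_eq_abs, abs_of_nonneg (by positivity), ← sq_abs]
    calc |(f w).toReal| ^ 2 * Real.exp (κ * ‖w‖ ^ 2)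
        ≤ Real.exp (c * ‖w‖ ^ (2 - ε)) ^ 2 * Real.exp (κ * ‖w‖ ^ 2) := by gcongr
      _ = Real.exp (2 * (c * ‖w‖ ^ (2 - ε)) + κ * ‖w‖ ^ 2) := by
          rw [← Real.exp_nat_mul, ← Real.exp_add]; push_cast; rfl
      _ ≤ _ := by
          refine Real.exp_le_exp.2 ?_
          rw [hδ] at h2
          linarith

/-- On integrable almost everywhere finite functions the extended integral is the Bochner integral. -/
lemma eintegral_eq_coe_integral {α : Type*} [MeasurableSpace α] {μ : Measure α} {h : α → EReal}
    (htop : ∀ x, h x ≠ ⊤) (hbot : ∀ᵐ x ∂μ, h x ≠ ⊥)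
    (hint : Integrable (fun x => (h x).toReal) μ) :
    eintegral μ h = ((∫ x, (h x).toReal ∂μ : ℝ) : EReal) := by
  have e1 : ∫⁻ x, (h x).toENNReal ∂μ = ∫⁻ x, ENNReal.ofReal (h x).toReal ∂μ :=
    lintegral_congr fun x => EReal.toENNReal_of_ne_top (htop x)
  have e2 : ∫⁻ x, (-h x).toENNReal ∂μ = ∫⁻ x, ENNReal.ofReal (-(h x).toReal) ∂μ := by
    refine lintegral_congr_ae ?_
    filter_upwards [hbot] with x hx
    rw [EReal.toENNReal_of_ne_top (by simpa using hx), EReal.toReal_neg_eq]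
  have f1 : ∫⁻ x, ENNReal.ofReal (h x).toReal ∂μ ≠ ⊤ := hint.lintegral_lt_top.ne
  have f2 : ∫⁻ x, ENNReal.ofReal (-(h x).toReal) ∂μ ≠ ⊤ := hint.neg.lintegral_lt_top.ne
  rw [eintegral, e1, e2, integral_eq_lintegral_pos_part_sub_lintegral_neg_part hint,
    EReal.coe_sub, EReal.coe_ennreal_toReal f1, EReal.coe_ennreal_toReal f2]

/-- Joint integrability over the angle and the centre of a circle. By Fubini, tame functions are
integrable along the circles around almost every point. -/
lemma Tame.integrable_add_circleMap {φ : Cn n → ℝ} (hφ : Tame φ) (c : Cn n) :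
    Integrable (fun p : ℝ × Cn n => φ (p.2 + circleMap 0 1 p.1 • c))
      (angleMeasure.prod (stdGaussian n)) := by
  have hm := hφ.measurable
  have hmeas : Measurable fun p : ℝ × Cn n => φ (p.2 + circleMap 0 1 p.1 • c) := by
    refine hm.comp (Continuous.measurable ?_)
    exact continuous_snd.add (((continuous_circleMap 0 1).comp continuous_fst).smul
      continuous_const)
  rw [integrable_prod_iff hmeas.aestronglyMeasurable]
  constructor
  · refine Eventually.of_forall fun θ => ?_
    have := (hφ.comp_affine (circleMap 0 1 θ • c) one_pos).integrable
    simpa only [one_smul, add_comm] using this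
  · refine Integrable.of_bound (C := Real.exp (2 * ‖c‖ ^ 2) *
      ∫ u, |φ u| * Real.exp (1 / 2 * ‖u‖ ^ 2) ∂stdGaussian n)
      hmeas.norm.aestronglyMeasurable.integral_prod_right' (Eventually.of_forall fun θ => ?_)
    rw [Real.norm_eq_abs, abs_of_nonneg (integral_nonneg fun _ => norm_nonneg _)]
    have h := integral_comp_add_circleMap_smul (φ := fun u => |φ u|) (by fun_prop) c 1 θ
    simp only [Complex.ofReal_one, one_smul] at h
    simp only [Real.norm_eq_abs]
    rw [h, ← integral_const_mul]
    refine integral_mono_of_nonneg (Eventually.of_forall fun u => by positivity)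
      ((hφ.integrable_mul_exp (by norm_num)).const_mul _) (Eventually.of_forall fun u => ?_)
    simp only
    rw [mul_left_comm (Real.exp (2 * ‖c‖ ^ 2)), ← Real.exp_add (2 * ‖c‖ ^ 2)]
    refine mul_le_mul_of_nonneg_left (Real.exp_le_exp.2 ?_) (abs_nonneg _)
    have := (le_abs_self _).trans (abs_inner_circleMap_re_le θ c u)
    nlinarith [sq_nonneg (2 * ‖c‖ - ‖u‖), sq_nonneg ‖c‖]

lemma ae_comp_affine_ne_bot {f : Cn n → EReal} (hf : Plurisubharmonic f) (hG : GrowthClass f)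
    (a : Cn n) {s : ℝ} (hs : 0 < s) : ∀ᵐ u ∂stdGaussian n, f (a + s • u) ≠ ⊥ := by
  have h1 : ∀ᵐ w ∂(stdGaussian n).map (fun v => a + s • v), f w ≠ ⊥ := by
    rw [map_add_smul_stdGaussian a hs]
    exact (withDensity_absolutelyContinuous _ _).ae_le
      (stdGaussian_absolutelyContinuous.ae_le (hG.ae_ne_bot hf))
  exact ae_of_ae_map (f := fun v => a + s • v) (p := fun w => f w ≠ ⊥) (by fun_prop) h1

/-- The sub-mean value inequality in terms of real values. It is needed, and holds, only at the
centres where `f` is finite and integrable along the circle; at a point where `f` is `-∞` the junk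
value `0` of `toReal` may violate it. -/
lemma affineSubmean_toReal {f : Cn n → EReal} (hf : Plurisubharmonic f) (hG : GrowthClass f) :
    AffineSubmean fun w => (f w).toReal := by
  intro a s hs c
  set φ : Cn n → ℝ := fun v => (f (a + s • v)).toReal with hφ
  have hT : Tame φ := (hG.tame hf).comp_affine a hs
  have hint := hT.integrable_add_circleMap c
  have hfm : Measurable f := hf.usc.measurable
  have hmeas : MeasurableSet {p : ℝ × Cn n | f (a + s • (p.2 + circleMap 0 1 p.1 • c)) ≠ ⊥} := by
    refine measurableSet_preimage (f := fun p : ℝ × Cn n => f (a + s • (p.2 + circleMap 0 1 p.1 • c)))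
      (hfm.comp (Continuous.measurable ?_)) (measurableSet_singleton ⊥).compl
    exact continuous_const.add ((continuous_snd.add (((continuous_circleMap 0 1).comp
      continuous_fst).smul continuous_const)).const_smul s)
  have hbot : ∀ᵐ u ∂stdGaussian n, ∀ᵐ θ ∂angleMeasure,
      f (a + s • (u + circleMap 0 1 θ • c)) ≠ ⊥ := by
    rw [← Measure.ae_ae_comm (p := fun θ u => f (a + s • (u + circleMap 0 1 θ • c)) ≠ ⊥) hmeas]
    refine Eventually.of_forall fun θ => ?_
    filter_upwards [ae_comp_affine_ne_bot hf hG (a + s • circleMap 0 1 θ • c) hs] with u hu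
    rwa [smul_add, add_comm (s • u), ← add_assoc]
  have hswap := integral_integral_swap (μ := angleMeasure) (ν := stdGaussian n)
    (f := fun θ u => φ (u + circleMap 0 1 θ • c)) hint
  rw [hswap]
  refine integral_mono_ae hT.integrable hint.integral_prod_right ?_
  filter_upwards [hbot, hint.prod_left_ae, ae_comp_affine_ne_bot hf hG a hs] with u h1 h2 h3
  have hle := (hf.subharmonic_line (a + s • u) (s • c)).le_mean 0 1 one_pos
  have e : ∀ θ, a + s • u + circleMap 0 1 θ • s • c = a + s • (u + circleMap 0 1 θ • c) := by
    intro θ; rw [smul_add, add_assoc, smul_comm s]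
  simp only [zero_smul, add_zero, e] at hle
  rw [eintegral_eq_coe_integral (fun θ => (hf.lt_top _).ne) h1 h2] at hle
  rw [← EReal.coe_le_coe_iff, hφ]
  simp only
  rwa [EReal.coe_toReal (hf.lt_top _).ne h3]

lemma CircularSymmetric.apply_smul {f : Cn n → EReal} (hf : CircularSymmetric f) (ω : ℂ) (w : Cn n)
    (hω : ‖ω‖ = 1) : f (ω • w) = f w := by
  have h := Complex.norm_mul_exp_arg_mul_I ω
  rw [hω, Complex.ofReal_one, one_mul] at h
  rw [← h]
  exact hf _ _

end Psh

end GaussianPsh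

open GaussianPsh in
/-- Correlation inequality. The functions `f` and `g` are finite almost everywhere, so their real
values `(f w).toReal` and `(g w).toReal` carry the integrals; that the three integrals exist is
part of the conclusion. -/
theorem theorem1 (n : ℕ) (f g : Cn n → EReal)
    (hf : Plurisubharmonic f) (hg : Plurisubharmonic g)
    (hfG : GrowthClass f) (hgG : GrowthClass g)
    (hfsymm : CircularSymmetric f) :
    (∀ᵐ w ∂stdGaussian n, f w ≠ ⊥ ∧ g w ≠ ⊥) ∧
    Integrable (fun w => (f w).toReal) (stdGaussian n) ∧
    Integrable (fun w => (g w).toReal) (stdGaussian n) ∧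
    Integrable (fun w => (f w).toReal * (g w).toReal) (stdGaussian n) ∧
    (∫ w, (f w).toReal ∂stdGaussian n) * (∫ w, (g w).toReal ∂stdGaussian n)
      ≤ ∫ w, (f w).toReal * (g w).toReal ∂stdGaussian n := by
  have hF := hfG.tame hf
  have hG := hgG.tame hg
  refine ⟨?_, hF.integrable, hG.integrable, ?_, ?_⟩
  · filter_upwards [stdGaussian_absolutelyContinuous.ae_le (hfG.ae_ne_bot hf),
      stdGaussian_absolutelyContinuous.ae_le (hgG.ae_ne_bot hg)] with w h1 h2 using ⟨h1, h2⟩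
  · exact MemLp.integrable_mul
      ((memLp_two_iff_integrable_sq hF.measurable.aestronglyMeasurable).2 hF.sq_integrable)
      ((memLp_two_iff_integrable_sq hG.measurable.aestronglyMeasurable).2 hG.sq_integrable)
  · have h := corr_zero_le_corr_one hF hG (affineSubmean_toReal hf hfG)
      (affineSubmean_toReal hg hgG) fun ω w hω => by rw [hfsymm.apply_smul ω w hω]
    rwa [corr_zero, corr_one] at h
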